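/- **Setup.** Let $s_i=(i,i+1)$, and let $w_0^{(n+1)}$ be the longest element of the symmetric group $\mathfrak S_{n+1}$, i.e. $n+1\ n\ \cdots\ 1$ in one-line notation. For $n\ge 0$ let $\mathscr R(w_0^{(n+1)})$ be the set of its reduced words $\mathbf i=(i_1,\dots,i_\ell)\in\{1,\dots,n\}^\ell$, $\ell=n(n+1)/2$, i.e. the words with $s_{i_1}\cdots s_{i_\ell}=w_0^{(n+1)}$. A *word poset* is a poset $P$ with a function $f_P:P\to\mathbb Z_{>0}$ ($f_P(x)$ is the column of $x$). The word poset $P_{\mathbf i}$ of $\mathbf i$ is the set $\{1,\dots,\ell\}$ with $f(j)=i_j$, ordered by the reflexive transitive closure of the relation "$j<k$ and $|i_j-i_k|=1$". Let $\mathcal P(w_0^{(n+1)})$ be the set of word posets isomorphic to $P_{\mathbf i}$ for some $\mathbf i\in\mathscr R(w_0^{(n+1)})$. For $n\ge1$, each $P\in\mathcal P(w_0^{(n+1)})$ contains exactly one chain $\mathsf D(P)=\{d_1<\dots<d_n\}$ with $f_P(d_i)=n+1-i$ and exactly one chain $\mathsf A(P)=\{a_1<\dots<a_n\}$ with $f_P(a_i)=i$.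 For $X\in\{\mathsf A,\mathsf D\}$: * $\mathrm{ind}_X(P)$ is the number of $k\in P$ with $k>c$ for the element $c\in X(P)$ in the same column as $k$; * $I_X(P)$ is the set of $k\in P$ with $k<c$ for the element $c\in X(P)$ in the same column as $k$; * $C_X(P)$ is the poset $P\setminus X(P)$ with the induced order and new column function: for $X=\mathsf D$, $f(k)=f_P(k)$ if $k\in I_{\mathsf D}(P)$ and $f(k)=f_P(k)-1$ otherwise; for $X=\mathsf A$, $f(k)=f_P(k)-1$ if $k\in I_{\mathsf A}(P)$ and $f(k)=f_P(k)$ otherwise. For $n\ge 2$ it belongs to $\mathcal P(w_0^{(n)})$. For $n\ge1$ and $\delta=(\delta_1,\dots,\delta_{n-1})\in\{\mathsf A,\mathsf D\}^{n-1}$, the $\delta$-index of $P\in\mathcal P(w_0^{(n+1)})$ is $\mathrm{ind}_\delta(P)=(I_1,\dots,I_{n-1})$ with $I_k=\mathrm{ind}_{\delta_k}(C_{\delta_{k+1}}\circ\cdots\circ C_{\delta_{n-1}}(P))$. A reduced word $\mathbf i\in\mathscr R(w_0^{(n+1)})$ is of *Gelfand–Cetlin type* if $\mathrm{ind}_\delta(P_{\mathbf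 i})=(0,\dots,0)$ for some $\delta\in\{\mathsf A,\mathsf D\}^{n-1}$; for $n\le 1$ the only $\delta$ is the empty sequence and the condition is void. Let $\mathsf{gc}(n)$ be the number of Gelfand–Cetlin type words in $\mathscr R(w_0^{(n+1)})$. For a strict partition $\mu=(\mu_1>\dots>\mu_t>0)$ let $\mu^*=\{(i,j): 1\le i\le t,\ i\le j\le \mu_i+i-1\}$, and let $g^\mu$ be the number of standard Young tableaux of shifted shape $\mu$, i.e. of bijections $T:\mu^*\to\{1,\dots,|\mu|\}$, where $|\mu|=\mu_1+\dots+\mu_t$, such that $T(i,j)\le T(i',j')$ whenever $i\le i'$ and $j\le j'$. **Theorem.** $\mathsf{gc}(0)=\mathsf{gc}(1)=1$, and for every $n\ge2$, $$\mathsf{gc}(n)=\sum_{i=1}^{n} g^{(n,n-1,\dots,n-i+1)}\,\mathsf{gc}(n-i).$$ -/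

import Mathlib

namespace GelfandCetlin

/-! ### Words and reduced words in the symmetric group

The symmetric group of degree `n + 1` is `Equiv.Perm (Fin (n + 1))`, and the letter
`i ∈ {1, …, n}` is represented by the element `i - 1` of `Fin n`. -/

/-- The simple transposition swapping two adjacent elements. -/
def simpleTransposition {n : ℕ} (i : Fin n) : Equiv.Perm (Fin (n + 1)) :=
  Equiv.swap i.castSucc i.succ

/-- The product `s_{i₁} ⋯ s_{i_r}` of the simple transpositions of a word. -/
def wordProd {n : ℕ} (w : List (Fin n)) : Equiv.Perm (Fin (n + 1)) :=
  (w.map simpleTransposition).prod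

/-- The length of a permutation: the smallest length of a word of it. -/
noncomputable def permLength {n : ℕ} (x : Equiv.Perm (Fin (n + 1))) : ℕ :=
  sInf {r : ℕ | ∃ w : List (Fin n), wordProd w = x ∧ w.length = r}

/-- `w` is a reduced word of `x`. -/
def IsReducedWord {n : ℕ} (w : List (Fin n)) (x : Equiv.Perm (Fin (n + 1))) : Prop :=
  wordProd w = x ∧ w.length = permLength x

/-- The longest element, `n+1 n … 1` in one-line notation. -/
def longestElement (n : ℕ) : Equiv.Perm (Fin (n + 1)) := Fin.revPerm

/-! ### Word posets -/

/-- A poset together with a column function. -/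
structure WordPoset where
  /-- the underlying set -/
  Carrier : Type
  /-- the partial order -/
  order : PartialOrder Carrier
  /-- the column of an element; columns are numbered from `1` -/
  col : Carrier → ℕ

instance WordPoset.instPartialOrder (P : WordPoset) : PartialOrder P.Carrier := P.order

/-- The generating relation of the poset of a word: `j < k`, and the letters in positions
`j` and `k` are adjacent integers. -/
def wordRel {n : ℕ} (w : List (Fin n)) (j k : Fin w.length) : Prop :=
  j < k ∧ ((w.get j : ℕ) + 1 = (w.get k : ℕ) ∨ (w.get k : ℕ) + 1 = (w.get j : ℕ))

theorem le_of_reflTransGen_wordRel {n : ℕ} (w : List (Fin n)) {j k : Fin w.length}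
    (h : Relation.ReflTransGen (wordRel w) j k) : j ≤ k := by
  induction h with
  | refl => exact le_refl _
  | tail _ hbc ih => exact ih.trans hbc.1.le

/-- The word poset of a word: its elements are the positions, its order is the reflexive
transitive closure of `wordRel`, and the column of a position is the letter in it. -/
def wordPoset {n : ℕ} (w : List (Fin n)) : WordPoset where
  Carrier := Fin w.length
  order :=
    { le := Relation.ReflTransGen (wordRel w)
      lt := fun j k => Relation.ReflTransGen (wordRel w) j k ∧
        ¬ Relation.ReflTransGen (wordRel w) k j
      lt_iff_le_not_ge := fun _ _ => Iff.rfl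
      le_refl := fun _ => Relation.ReflTransGen.refl
      le_trans := fun _ _ _ h₁ h₂ => h₁.trans h₂
      le_antisymm := fun _ _ h₁ h₂ => le_antisymm
        (le_of_reflTransGen_wordRel w h₁) (le_of_reflTransGen_wordRel w h₂) }
  col := fun j => (w.get j : ℕ) + 1

/-! ### Chains, indices and contractions -/

/-- The two letters `A` (ascending) and `D` (descending). -/
inductive Dir
  | A
  | D

/-- The column of the `i`-th element (counted from `0`) of the ascending chain
(columns `1, 2, …, m`) or of the descending chain (columns `m, m - 1, …, 1`). -/
def Dir.chainCol (m : ℕ) (i : Fin m) : Dir → ℕ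
  | Dir.A => (i : ℕ) + 1
  | Dir.D => m - (i : ℕ)

namespace WordPoset

/-- The set of elements of the ascending chain `A(P)` or of the descending chain `D(P)` of a
word poset with columns `1, …, m`, that is, of a chain `c₁ < ⋯ < c_m` in which `c_i` is in
column `i`, respectively in column `m + 1 - i`. A word poset of a reduced word of the longest
element has exactly one such chain of each kind. -/
def chain (P : WordPoset) (m : ℕ) (δ : Dir) : Set P.Carrier :=
  {x | ∃ c : Fin m → P.Carrier,
    StrictMono c ∧ (∀ i, P.col (c i) = δ.chainCol m i) ∧ x ∈ Set.range c}

/-- The `A`-index or `D`-index: the number of elements above the chain, that is, greater than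
the element of the chain in the same column. -/
noncomputable def index (P : WordPoset) (m : ℕ) (δ : Dir) : ℕ :=
  {k : P.Carrier | ∃ c ∈ P.chain m δ, c < k ∧ P.col k = P.col c}.ncard

/-- The contraction ideal: the elements below the chain, that is, smaller than the element of
the chain in the same column. -/
def contractionIdeal (P : WordPoset) (m : ℕ) (δ : Dir) : Set P.Carrier :=
  {k | ∃ c ∈ P.chain m δ, k < c ∧ P.col k = P.col c}

open Classical in
/-- The contraction: remove the chain, keep the induced order, and shift one column to the left
the part below the chain (for `A`), respectively the rest (for `D`). -/
noncomputable def contract (P : WordPoset) (m : ℕ) (δ : Dir) : WordPoset where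
  Carrier := {k : P.Carrier // k ∉ P.chain m δ}
  order := Subtype.partialOrder _
  col := fun k =>
    match δ with
    | Dir.A => if k.1 ∈ P.contractionIdeal m Dir.A then P.col k.1 - 1 else P.col k.1
    | Dir.D => if k.1 ∈ P.contractionIdeal m Dir.D then P.col k.1 else P.col k.1 - 1

/-- The `δ`-index `(I₁, …, I_m)` of a word poset with columns `1, …, m + 1`, where
`δ = (δ₁, …, δ_m)`: the last entry is the `δ_m`-index of the poset, and the preceding entries
are the `(δ₁, …, δ_{m-1})`-index of its `δ_m`-contraction, which has columns `1, …, m`. -/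
noncomputable def deltaIndex : (m : ℕ) → (Fin m → Dir) → WordPoset → (Fin m → ℕ)
  | 0, _, _ => Fin.elim0
  | m + 1, δ, P =>
    Fin.snoc (α := fun _ => ℕ)
      (deltaIndex m (Fin.init δ) (P.contract (m + 2) (δ (Fin.last m))))
      (P.index (m + 2) (δ (Fin.last m)))

end WordPoset

/-- A word in the letters `1, …, n` is of Gelfand–Cetlin type if its word poset has `δ`-index
`(0, …, 0)` for some `δ ∈ {A, D}^{n-1}` (for the empty sequence `δ` if `n ≤ 1`). -/
def IsGelfandCetlinType {n : ℕ} (w : List (Fin n)) : Prop :=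
  ∃ δ : Fin (n - 1) → Dir, (wordPoset w).deltaIndex (n - 1) δ = 0

/-- The number of reduced words of Gelfand–Cetlin type of the longest element of the symmetric
group of degree `n + 1`. -/
noncomputable def gc (n : ℕ) : ℕ :=
  {w : List (Fin n) | IsReducedWord w (longestElement n) ∧ IsGelfandCetlinType w}.ncard

/-! ### Standard Young tableaux of shifted shape -/

/-- The shifted diagram of `μ = (μ₁, …, μ_t)`, with rows and columns numbered from `0`: row `i`
consists of the `μ i` cells in columns `i, i + 1, …, i + μ i - 1`. -/
def shiftedDiagram {t : ℕ} (μ : Fin t → ℕ) : Set (Fin t × ℕ) :=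
  {p | (p.1 : ℕ) ≤ p.2 ∧ p.2 < μ p.1 + (p.1 : ℕ)}

/-- The number of standard Young tableaux of shifted shape `μ`: bijections from the cells to
`{1, …, |μ|}` (written here as `Fin |μ|`) that are monotone for the componentwise order. -/
noncomputable def numShiftedSYT {t : ℕ} (μ : Fin t → ℕ) : ℕ :=
  Nat.card {T : shiftedDiagram μ ≃ Fin (∑ i, μ i) // Monotone T}

end GelfandCetlin

/-! A reduced word of the longest element is a wiring diagram in which any two wires cross exactly
once, so the smallest wire only moves to the right. Its crossings form the unique ascending chain of
the word poset (`exists_isAscendingRun`, `IsAscendingRun.chain_eq`). The `A`-index is zero exactly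
when the chain consists of the last occurrences of all letters. The chain can then be moved to the
end of the word by commutations, and the contraction is the word poset of the remaining word
(`IsAscendingRun.exists_contract`). Reversing the alphabet gives the same for descending chains.
By induction, the reduced words of `δ`-index zero are exactly the words that commutations make from
one explicit word `gcWord m δ` (`isReducedWord_and_deltaIndex_eq_zero_iff`), and different `δ` give
different classes (`gcWord_injective`). So the number of words of Gelfand–Cetlin type is the sum
over `δ` of the sizes of these commutation classes.

Suppose that `δ` ends in an `A` followed by exactly `i` letters `D`. The ascending chain
`0, 1, …, c` of that `A` forces every word before the `D` part to end in `c`, and every word of the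
`D` part starts with `c + 1`. Hence no letter moves from one part into the other, and the size of
the class is a product (`traceCard_append`). The `D` part consists of `i` descending chains of
lengths `n - i + 1, …, n`; read backwards, these are the rows of the shifted diagram of
`(n, n - 1, …, n - i + 1)`, and the words of the class are its standard tableaux
(`traceCard_descChains`). By reversal of the alphabet, half of all words have a `δ` ending in `A`,
and half have one ending in `D`. Doubling the sum over the words with last letter `D` therefore
gives the recursion (`two_mul_descTailCount`). The two terms with `i = n - 1` and `i = n` both come
from `δ = (D, …, D)`: adding the last cell to the shifted diagram does not change the number of
tableaux.

Commutation equivalence is represented throughout by equality of the subwords on two adjacent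
letters (`TraceEq`), which makes cancellation and splitting of words easy. -/

namespace GelfandCetlin

/-! ### Commutation equivalence of words -/

section

/-- The subword of `w` on the two adjacent letters `j` and `j + 1`. The letters of words are
numbered from `0` here. -/
def adjFilter (j : ℕ) (w : List ℕ) : List ℕ :=
  w.filter fun x => x = j ∨ x = j + 1

/-- Equality up to commutations of letters `x`, `y` with `|x - y| ≥ 2`. It is encoded by the
projection criterion for partially commutative monoids: all subwords on two adjacent letters
agree. This makes cancellation immediate. -/
def TraceEq (w v : List ℕ) : Prop :=
  ∀ j, adjFilter j w = adjFilter j v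

@[simp] theorem adjFilter_nil (j : ℕ) : adjFilter j [] = [] := rfl

@[simp] theorem adjFilter_append (j : ℕ) (w v : List ℕ) :
    adjFilter j (w ++ v) = adjFilter j w ++ adjFilter j v :=
  List.filter_append ..

theorem adjFilter_cons_of_pos {j x : ℕ} (w : List ℕ) (h : x = j ∨ x = j + 1) :
    adjFilter j (x :: w) = x :: adjFilter j w :=
  List.filter_cons_of_pos (by simpa using h)

theorem adjFilter_cons_of_neg {j x : ℕ} (w : List ℕ) (h : ¬(x = j ∨ x = j + 1)) :
    adjFilter j (x :: w) = adjFilter j w :=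
  List.filter_cons_of_neg (by simpa using h)

theorem mem_adjFilter {j x : ℕ} {w : List ℕ} :
    x ∈ adjFilter j w ↔ x ∈ w ∧ (x = j ∨ x = j + 1) := by
  simp [adjFilter]

namespace TraceEq

theorem refl (w : List ℕ) : TraceEq w w := fun _ => rfl

theorem symm {w v : List ℕ} (h : TraceEq w v) : TraceEq v w := fun j => (h j).symm

theorem trans {u w v : List ℕ} (h : TraceEq u w) (h' : TraceEq w v) : TraceEq u v :=
  fun j => (h j).trans (h' j)

theorem append {w v w' v' : List ℕ} (h : TraceEq w v) (h' : TraceEq w' v') :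
    TraceEq (w ++ w') (v ++ v') := fun j => by
  rw [adjFilter_append, adjFilter_append, h j, h' j]

theorem of_append_right {w v u : List ℕ} (h : TraceEq (w ++ u) (v ++ u)) : TraceEq w v :=
  fun j => by simpa using h j

theorem reverse {w v : List ℕ} (h : TraceEq w v) : TraceEq w.reverse v.reverse := fun j => by
  have := h j
  simp only [adjFilter, List.filter_reverse] at this ⊢
  rw [this]

/-- `TraceEq` preserves every subword on a set of letters contained in some `{j, j + 1}`. -/
theorem filter_eq {w v : List ℕ} (h : TraceEq w v) (j : ℕ) (p : ℕ → Bool)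
    (hp : ∀ x, p x → x = j ∨ x = j + 1) : w.filter p = v.filter p := by
  have key : ∀ u : List ℕ, u.filter p = (adjFilter j u).filter p := fun u => by
    rw [adjFilter, List.filter_filter]
    refine List.filter_congr fun x _ => ?_
    by_cases hx : p x
    · simp [hx, hp x hx]
    · simp [hx]
  rw [key w, key v, h j]

theorem perm {w v : List ℕ} (h : TraceEq w v) : w.Perm v := by
  rw [List.perm_iff_count]
  intro a
  rw [List.count_eq_length_filter, List.count_eq_length_filter,
    h.filter_eq a _ fun x hx => Or.inl (by simpa using hx)]

theorem length_eq {w v : List ℕ} (h : TraceEq w v) : w.length = v.length := h.perm.length_eq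

theorem mem_iff {w v : List ℕ} (h : TraceEq w v) {x : ℕ} : x ∈ w ↔ x ∈ v := h.perm.mem_iff

theorem eq_nil {w : List ℕ} (h : TraceEq w []) : w = [] := h.perm.eq_nil

end TraceEq

theorem finite_setOf_traceEq (v : List ℕ) : {w | TraceEq w v}.Finite :=
  (List.finite_toSet v.permutations).subset fun _ h => List.mem_permutations.2 (TraceEq.perm h)

theorem adjFilter_map_add_one (j : ℕ) (w : List ℕ) :
    adjFilter (j + 1) (w.map (· + 1)) = (adjFilter j w).map (· + 1) := by
  simp only [adjFilter, List.filter_map]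
  congr 1
  refine List.filter_congr fun x _ => ?_
  simp

theorem traceEq_map_add_one_iff {w v : List ℕ} :
    TraceEq (w.map (· + 1)) (v.map (· + 1)) ↔ TraceEq w v := by
  refine ⟨fun h j => ?_, fun h j => ?_⟩
  · have := h (j + 1)
    rw [adjFilter_map_add_one, adjFilter_map_add_one] at this
    exact List.map_injective_iff.2 (add_left_injective 1) this
  · cases j with
    | zero =>
      simp only [adjFilter, List.filter_map]
      rw [h.filter_eq 0]
      simp
    | succ j => rw [adjFilter_map_add_one, adjFilter_map_add_one, h j]

theorem eq_nil_of_append_cons_eq_concat {α : Type*} {A B C : List α} {y : α}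
    (h : B ++ [y] = A ++ y :: C) (hy : y ∉ C) : C = [] := by
  rcases List.eq_nil_or_concat C with rfl | ⟨C', c, rfl⟩
  · rfl
  · have h2 : B ++ [y] = (A ++ y :: C') ++ [c] := by simpa using h
    have := (List.append_inj' h2 rfl).2
    simp_all

/-- The last letter `y` of a word occurs in every equivalent word, and its last occurrence can be
moved to the end by commutations. -/
theorem TraceEq.exists_of_concat {w X : List ℕ} {y : ℕ} (h : TraceEq (w ++ [y]) X) :
    ∃ X₁ X₂, X = X₁ ++ y :: X₂ ∧ (∀ z ∈ X₂, z ≠ y ∧ z + 1 ≠ y ∧ y + 1 ≠ z) ∧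
      TraceEq w (X₁ ++ X₂) := by
  have hy : y ∈ X := h.mem_iff.1 (by simp)
  -- Reversing `X` turns the first occurrence of `y` into the last one.
  obtain ⟨A, B, hX, hA⟩ := List.eq_append_cons_of_mem (List.mem_reverse.2 hy)
  have hX' : X = B.reverse ++ y :: A.reverse := by
    have := congrArg List.reverse hX
    simpa using this
  have hA' : y ∉ A.reverse := by simpa using hA
  generalize B.reverse = X₁ at hX'
  generalize A.reverse = X₂ at hX' hA'
  have key : ∀ j, (y = j ∨ y = j + 1) → adjFilter j X₂ = [] := fun j hj => by
    have := h j
    subst hX'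
    rw [adjFilter_append, adjFilter_append] at this
    rw [adjFilter_cons_of_pos _ hj, adjFilter_cons_of_pos _ hj, adjFilter_nil] at this
    exact eq_nil_of_append_cons_eq_concat this fun hm => hA' (mem_adjFilter.1 hm).1
  refine ⟨X₁, X₂, hX', fun z hz => ⟨?_, ?_, ?_⟩, fun j => ?_⟩
  · rintro rfl; exact hA' hz
  · rintro rfl
    have := key z (Or.inr rfl)
    have hm : z ∈ adjFilter z X₂ := mem_adjFilter.2 ⟨hz, Or.inl rfl⟩
    simp [this] at hm
  · rintro rfl
    have := key y (Or.inl rfl)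
    have hm : y + 1 ∈ adjFilter y X₂ := mem_adjFilter.2 ⟨hz, Or.inr rfl⟩
    simp [this] at hm
  · have := h j
    subst hX'
    by_cases hj : y = j ∨ y = j + 1
    · rw [adjFilter_append, adjFilter_append, adjFilter_cons_of_pos _ hj,
        adjFilter_cons_of_pos _ hj, key j hj, adjFilter_nil] at this
      rw [adjFilter_append, key j hj, List.append_nil]
      exact List.append_cancel_right this
    · rwa [adjFilter_append, adjFilter_append, adjFilter_cons_of_neg _ hj,
        adjFilter_cons_of_neg _ hj, adjFilter_nil, List.append_nil, ← adjFilter_append] at this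

/-- Moving a letter to the end of a word past letters that commute with it. -/
theorem traceEq_move_last {X₁ X₂ : List ℕ} {y : ℕ}
    (h : ∀ z ∈ X₂, z ≠ y ∧ z + 1 ≠ y ∧ y + 1 ≠ z) :
    TraceEq (X₁ ++ y :: X₂) (X₁ ++ X₂ ++ [y]) := fun j => by
  by_cases hj : y = j ∨ y = j + 1
  · have : adjFilter j X₂ = [] := by
      rw [adjFilter, List.filter_eq_nil_iff]
      intro z hz
      have := h z hz
      simp only [decide_eq_true_eq]
      omega
    simp [adjFilter_cons_of_pos, hj, this]
  · simp [adjFilter_cons_of_neg, hj]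

/-- If every word equivalent to `U` ends in `c`, every word equivalent to `V` starts with `d`,
and `c`, `d` do not commute, then no letter of `V` can be moved into `U`. -/
theorem TraceEq.exists_append_eq {U : List ℕ} {c d : ℕ}
    (hU : ∀ u y, TraceEq (u ++ [y]) U → y = c) (hcd : c + 1 = d ∨ d + 1 = c) :
    ∀ (w V : List ℕ), (∀ v y, TraceEq (y :: v) V → y = d) → TraceEq w (U ++ V) →
      ∃ w₁ w₂, w = w₁ ++ w₂ ∧ TraceEq w₁ U ∧ TraceEq w₂ V := by
  intro w
  induction w using List.reverseRecOn with
  | nil =>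
    intro V _ h
    have := h.symm.eq_nil
    rw [List.append_eq_nil_iff] at this
    obtain ⟨rfl, rfl⟩ := this
    exact ⟨[], [], rfl, .refl _, .refl _⟩
  | append_singleton w y ih =>
    intro V hV h
    rcases V with _ | ⟨b, V⟩
    · exact ⟨w ++ [y], [], by simp, by simpa using h, .refl _⟩
    have hb : b = d := hV V b (.refl _)
    obtain ⟨X₁, X₂, hX, hcomm, hw⟩ := h.exists_of_concat
    rcases List.append_eq_append_iff.1 hX with ⟨A, rfl, hA⟩ | ⟨A, hU', hA⟩
    · have hVA : TraceEq (b :: V) (A ++ X₂ ++ [y]) := by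
        rw [hA]; exact traceEq_move_last hcomm
      obtain ⟨w₁, w₂, rfl, h1, h2⟩ := ih (A ++ X₂)
        (fun v z hz => hV (v ++ [y]) z ((hz.append (.refl [y])).trans hVA.symm))
        (by simpa using hw)
      exact ⟨w₁, w₂ ++ [y], by simp, h1, (h2.append (.refl [y])).trans hVA.symm⟩
    · rcases A with _ | ⟨a, A⟩
      · simp only [List.append_nil, List.nil_append] at hU' hA
        subst hU'
        have hVA : TraceEq (b :: V) (X₂ ++ [y]) := by
          rw [← hA]; exact traceEq_move_last (X₁ := []) hcomm
        obtain ⟨w₁, w₂, rfl, h1, h2⟩ := ih X₂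
          (fun v z hz => hV (v ++ [y]) z ((hz.append (.refl [y])).trans hVA.symm)) hw
        exact ⟨w₁, w₂ ++ [y], by simp, h1, (h2.append (.refl [y])).trans hVA.symm⟩
      · -- `y` would be moved out of `U` past `d`, but it equals `c`.
        exfalso
        simp only [List.cons_append, List.cons.injEq] at hA
        obtain ⟨rfl, hA⟩ := hA
        have hyc : y = c := by
          refine hU (X₁ ++ A) y ?_
          rw [hU']
          exact (traceEq_move_last fun z hz => hcomm z (by rw [hA]; simp [hz])).symm
        have := hcomm b (by rw [hA]; simp)
        omega

end

/-! ### Products of simple transpositions -/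

section

variable {n : ℕ}

theorem wordProd_nil : wordProd ([] : List (Fin n)) = 1 := rfl

theorem wordProd_cons (i : Fin n) (w : List (Fin n)) :
    wordProd (i :: w) = simpleTransposition i * wordProd w := by
  simp [wordProd]

theorem wordProd_append (w v : List (Fin n)) : wordProd (w ++ v) = wordProd w * wordProd v := by
  simp [wordProd]

theorem simpleTransposition_succ_zero (i : Fin n) : simpleTransposition i.succ 0 = 0 := by
  rw [simpleTransposition, Equiv.swap_apply_of_ne_of_ne]
  · rw [Fin.castSucc_succ]; exact (Fin.succ_ne_zero _).symm
  · exact (Fin.succ_ne_zero _).symm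

theorem simpleTransposition_succ_succ (i : Fin n) (x : Fin (n + 1)) :
    simpleTransposition i.succ x.succ = (simpleTransposition i x).succ := by
  rw [simpleTransposition, simpleTransposition, Fin.castSucc_succ, ← Fin.coe_succEmb,
    (Fin.succEmb _).injective.swap_apply]

theorem wordProd_map_succ_zero (w : List (Fin n)) : wordProd (w.map Fin.succ) 0 = 0 := by
  induction w with
  | nil => rfl
  | cons i w ih =>
    rw [List.map_cons, wordProd_cons, Equiv.Perm.mul_apply, ih, simpleTransposition_succ_zero]

theorem wordProd_map_succ_succ (w : List (Fin n)) (x : Fin (n + 1)) :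
    wordProd (w.map Fin.succ) x.succ = (wordProd w x).succ := by
  induction w with
  | nil => rfl
  | cons i w ih =>
    rw [List.map_cons, wordProd_cons, Equiv.Perm.mul_apply, ih, simpleTransposition_succ_succ,
      wordProd_cons, Equiv.Perm.mul_apply]

theorem wordProd_finRange_last (n : ℕ) : wordProd (List.finRange n) (Fin.last n) = 0 := by
  induction n with
  | zero => rfl
  | succ n ih =>
    rw [List.finRange_succ, wordProd_cons, Equiv.Perm.mul_apply, ← Fin.succ_last,
      wordProd_map_succ_succ, ih]
    simp [simpleTransposition]

theorem wordProd_finRange_castSucc (x : Fin n) :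
    wordProd (List.finRange n) x.castSucc = x.succ := by
  induction n with
  | zero => exact x.elim0
  | succ n ih =>
    rw [List.finRange_succ, wordProd_cons, Equiv.Perm.mul_apply]
    cases x using Fin.cases with
    | zero => simp [wordProd_map_succ_zero, simpleTransposition]
    | succ y =>
      rw [Fin.castSucc_succ, wordProd_map_succ_succ, ih, simpleTransposition,
        Equiv.swap_apply_of_ne_of_ne]
      · simp
      · simp [Fin.ext_iff]

theorem simpleTransposition_rev (i : Fin n) :
    simpleTransposition i.rev = Fin.revPerm * simpleTransposition i * Fin.revPerm := by
  have : (Fin.revPerm : Equiv.Perm (Fin (n + 1)))⁻¹ = Fin.revPerm := rfl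
  conv_rhs => rw [← this]
  nth_rewrite 1 [this]
  rw [simpleTransposition, simpleTransposition, Equiv.swap_comm, ← Fin.rev_castSucc,
    ← Fin.rev_succ, ← Equiv.swap_apply_apply]
  rfl

theorem revPerm_mul_revPerm :
    (Fin.revPerm : Equiv.Perm (Fin n)) * Fin.revPerm = 1 := by
  ext x; simp

theorem wordProd_map_rev (w : List (Fin n)) :
    wordProd (w.map Fin.rev) = Fin.revPerm * wordProd w * Fin.revPerm := by
  induction w with
  | nil => simp [wordProd_nil, revPerm_mul_revPerm]
  | cons i w ih =>
    rw [List.map_cons, wordProd_cons, ih, simpleTransposition_rev, wordProd_cons]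
    calc _ = Fin.revPerm * simpleTransposition i * (Fin.revPerm * Fin.revPerm) * wordProd w *
          Fin.revPerm := by simp only [mul_assoc]
      _ = _ := by rw [revPerm_mul_revPerm]; simp only [mul_assoc, one_mul]

theorem wordProd_map_rev_eq_longestElement_iff {w : List (Fin n)} :
    wordProd (w.map Fin.rev) = longestElement n ↔ wordProd w = longestElement n := by
  have h : (Fin.revPerm : Equiv.Perm (Fin (n + 1))) = Fin.revPerm * Fin.revPerm * Fin.revPerm := by
    rw [revPerm_mul_revPerm, one_mul]
  rw [wordProd_map_rev, longestElement]
  conv_lhs => rhs; rw [h]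
  rw [mul_left_inj, mul_right_inj]

theorem simpleTransposition_commute {i j : Fin n} (h : i ≠ j) (h₁ : (i : ℕ) + 1 ≠ j)
    (h₂ : (j : ℕ) + 1 ≠ i) : Commute (simpleTransposition i) (simpleTransposition j) := by
  refine Equiv.Perm.Disjoint.commute (Equiv.Perm.disjoint_swap_swap ?_)
  have := Fin.val_ne_of_ne h
  simp [Fin.ext_iff]
  omega

theorem wordProd_commute {w : List (Fin n)} {i : Fin n}
    (h : ∀ j ∈ w, j ≠ i ∧ (j : ℕ) + 1 ≠ i ∧ (i : ℕ) + 1 ≠ j) :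
    Commute (simpleTransposition i) (wordProd w) := by
  rw [wordProd]
  refine Commute.list_prod_right _ _ fun x hx => ?_
  obtain ⟨j, hj, rfl⟩ := List.mem_map.1 hx
  obtain ⟨h₁, h₂, h₃⟩ := h j hj
  exact simpleTransposition_commute h₁.symm h₃ h₂

/-- Commutations do not change the product of a word. -/
theorem TraceEq.wordProd_eq {w v : List (Fin n)}
    (h : TraceEq (w.map Fin.val) (v.map Fin.val)) : wordProd w = wordProd v := by
  induction w using List.reverseRecOn generalizing v with
  | nil =>
    have := h.symm.eq_nil
    rw [List.map_eq_nil_iff.1 this]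
  | append_singleton w y ih =>
    rw [List.map_append] at h
    obtain ⟨X₁, X₂, hX, hcomm, hw⟩ := h.exists_of_concat
    obtain ⟨v₁, v', rfl, rfl, h'⟩ := List.map_eq_append_iff.1 hX
    obtain ⟨y', v₂, rfl, hy, rfl⟩ := List.map_eq_cons_iff.1 h'
    obtain rfl : y' = y := Fin.ext hy
    rw [← List.map_append] at hw
    rw [wordProd_append, ih hw, wordProd_append, wordProd_append, wordProd_cons, wordProd_cons,
      wordProd_nil, mul_one, mul_assoc, (wordProd_commute fun j hj => ?_).eq]
    have := hcomm j (List.mem_map_of_mem hj)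
    exact ⟨fun h => this.1 (congrArg Fin.val h), this.2⟩

/-! ### Appending a chain to a word -/

/-- The word obtained from `w` by adding one letter to the alphabet and appending an ascending or
a descending chain: for `A` the letters of `w` are raised by one and `0, 1, …, n` is appended, for
`D` the letters are kept and `n, …, 1, 0` is appended. This inverts the contraction of a word poset
of index `0`. -/
def appendChain : Dir → List (Fin n) → List (Fin (n + 1))
  | Dir.A, w => w.map Fin.succ ++ List.finRange (n + 1)
  | Dir.D, w => w.map Fin.castSucc ++ (List.finRange (n + 1)).reverse

/-- The other letter of `A`, `D`. -/
def Dir.flip : Dir → Dir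
  | Dir.A => Dir.D
  | Dir.D => Dir.A

theorem Dir.flip_flip (d : Dir) : d.flip.flip = d := by cases d <;> rfl

theorem map_rev_map_rev (w : List (Fin n)) : (w.map Fin.rev).map Fin.rev = w := by
  simp [List.map_map, Function.comp_def]

theorem map_rev_appendChain (d : Dir) (w : List (Fin n)) :
    (appendChain d w).map Fin.rev = appendChain d.flip (w.map Fin.rev) := by
  have h : (List.finRange (n + 1)).map Fin.rev = (List.finRange (n + 1)).reverse :=
    List.finRange_reverse.symm
  cases d
  · simp only [appendChain, Dir.flip, List.map_append, h, List.map_map]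
    congr 2
    funext x; simp [Fin.rev_succ]
  · simp only [appendChain, Dir.flip, List.map_append, h, List.map_map, List.map_reverse,
      List.reverse_reverse]
    congr 2
    funext x; simp [Fin.rev_castSucc]

theorem length_appendChain (d : Dir) (w : List (Fin n)) :
    (appendChain d w).length = w.length + (n + 1) := by
  cases d <;> simp [appendChain]

theorem wordProd_appendChain_A {w : List (Fin n)} (h : wordProd w = longestElement n) :
    wordProd (appendChain .A w) = longestElement (n + 1) := by
  rw [appendChain, wordProd_append]
  ext x
  rw [Equiv.Perm.mul_apply]
  cases x using Fin.lastCases with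
  | last => rw [wordProd_finRange_last, wordProd_map_succ_zero]; simp [longestElement]
  | cast x =>
    rw [wordProd_finRange_castSucc, wordProd_map_succ_succ, h]
    simp [longestElement, Fin.rev_castSucc]

theorem wordProd_appendChain {w : List (Fin n)} (d : Dir) (h : wordProd w = longestElement n) :
    wordProd (appendChain d w) = longestElement (n + 1) := by
  cases d with
  | A => exact wordProd_appendChain_A h
  | D =>
    rw [← wordProd_map_rev_eq_longestElement_iff, map_rev_appendChain]
    exact wordProd_appendChain_A (wordProd_map_rev_eq_longestElement_iff.2 h)

theorem wordProd_appendChain_inj_A {w v : List (Fin n)}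
    (h : wordProd (appendChain .A w) = wordProd (appendChain .A v)) : wordProd w = wordProd v := by
  rw [appendChain, wordProd_append, appendChain, wordProd_append, mul_left_inj] at h
  ext x : 1
  have := congrArg (fun π => π x.succ) h
  simpa [wordProd_map_succ_succ] using this

theorem wordProd_appendChain_inj {w v : List (Fin n)} (d : Dir)
    (h : wordProd (appendChain d w) = wordProd (appendChain d v)) : wordProd w = wordProd v := by
  cases d with
  | A => exact wordProd_appendChain_inj_A h
  | D =>
    have h2 : wordProd (appendChain .A (w.map Fin.rev)) =
        wordProd (appendChain .A (v.map Fin.rev)) := by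
      have := congrArg (fun π => Fin.revPerm * π * Fin.revPerm) h
      simpa only [← wordProd_map_rev, map_rev_appendChain, Dir.flip] using this
    have := wordProd_appendChain_inj_A h2
    rwa [wordProd_map_rev, wordProd_map_rev, mul_left_inj, mul_right_inj] at this

/-- The reduced word of the longest element built from the one-letter word by appending the chains
prescribed by `δ`; it represents the unique commutation class of `δ`-index `0`. -/
def gcWord : (m : ℕ) → (Fin m → Dir) → List (Fin (m + 1))
  | 0, _ => [0]
  | m + 1, δ => appendChain (δ (Fin.last m)) (gcWord m (Fin.init δ))

theorem map_rev_gcWord (m : ℕ) (δ : Fin m → Dir) :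
    (gcWord m δ).map Fin.rev = gcWord m fun i => (δ i).flip := by
  induction m with
  | zero => rfl
  | succ m ih => rw [gcWord, map_rev_appendChain, ih]; rfl

theorem wordProd_gcWord (m : ℕ) (δ : Fin m → Dir) :
    wordProd (gcWord m δ) = longestElement (m + 1) := by
  induction m with
  | zero => decide +revert
  | succ m ih => exact wordProd_appendChain _ (ih _)

theorem length_gcWord (m : ℕ) (δ : Fin m → Dir) :
    (gcWord m δ).length = (m + 2).choose 2 := by
  induction m with
  | zero => rfl
  | succ m ih =>
    rw [gcWord, length_appendChain, ih, Nat.choose_succ_succ' (m + 2) 1, Nat.choose_one_right,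
      add_comm]

/-! ### Crossings of wires and the length of the longest element -/

/-- The pairs of values crossing in the wiring diagram of `w` that starts from the arrangement `π`,
in which the value at position `p` is `π p`: a letter `i` swaps the values at the positions `i` and
`i + 1`. -/
def crossings : Equiv.Perm (Fin (n + 1)) → List (Fin n) → List (Sym2 (Fin (n + 1)))
  | _, [] => []
  | π, i :: w => s(π i.castSucc, π i.succ) :: crossings (π * simpleTransposition i) w

theorem length_crossings (π : Equiv.Perm (Fin (n + 1))) (w : List (Fin n)) :
    (crossings π w).length = w.length := by
  induction w generalizing π with
  | nil => rfl
  | cons i w ih => simp [crossings, ih]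

theorem crossings_append (π : Equiv.Perm (Fin (n + 1))) (w v : List (Fin n)) :
    crossings π (w ++ v) = crossings π w ++ crossings (π * wordProd w) v := by
  induction w generalizing π with
  | nil => simp [crossings, wordProd_nil]
  | cons i w ih => simp [crossings, ih, wordProd_cons, mul_assoc]

/-- The only pair whose order a simple transposition reverses is the pair it swaps. -/
theorem simpleTransposition_lt {i : Fin n} {x y : Fin (n + 1)} (h : x < y)
    (h' : simpleTransposition i y < simpleTransposition i x) : x = i.castSucc ∧ y = i.succ := by
  simp only [simpleTransposition, Equiv.swap_apply_def] at h'
  rw [Fin.lt_def] at h h'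
  split_ifs at h' <;> simp_all [Fin.ext_iff] <;> omega

/-- Two values whose order in the arrangement is reversed by a word cross in its wiring diagram. -/
theorem mem_crossings {w : List (Fin n)} {π : Equiv.Perm (Fin (n + 1))} {a b : Fin (n + 1)}
    (h : π⁻¹ a < π⁻¹ b) (h' : (π * wordProd w)⁻¹ b < (π * wordProd w)⁻¹ a) :
    s(a, b) ∈ crossings π w := by
  induction w generalizing π with
  | nil => rw [wordProd_nil, mul_one] at h'; exact absurd h h'.asymm
  | cons i w ih =>
    rw [crossings, List.mem_cons]
    by_cases hlt : (π * simpleTransposition i)⁻¹ a < (π * simpleTransposition i)⁻¹ b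
    · right
      exact ih hlt (by rwa [mul_assoc, ← wordProd_cons])
    · left
      have hab : a ≠ b := by rintro rfl; exact lt_irrefl _ h
      have hlt' := lt_of_le_of_ne (not_lt.1 hlt)
        fun e => hab ((π * simpleTransposition i)⁻¹.injective e).symm
      have hs : (simpleTransposition i)⁻¹ = simpleTransposition i := Equiv.swap_inv _ _
      rw [mul_inv_rev, hs, Equiv.Perm.mul_apply, Equiv.Perm.mul_apply] at hlt'
      obtain ⟨hx, hy⟩ := simpleTransposition_lt h hlt'
      rw [← hx, ← hy]
      simp

theorem mem_crossings_longestElement {w : List (Fin n)} (h : wordProd w = longestElement n)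
    {e : Sym2 (Fin (n + 1))} (he : ¬ e.IsDiag) : e ∈ crossings 1 w := by
  induction e with | _ a b
  rw [Sym2.mk_isDiag_iff] at he
  wlog hab : a < b generalizing a b
  · rw [Sym2.eq_swap]
    exact this b a (Ne.symm he) (lt_of_le_of_ne (not_lt.1 hab) (Ne.symm he))
  refine mem_crossings (by simpa using hab) ?_
  rw [one_mul, h]
  show Fin.rev b < Fin.rev a
  exact Fin.rev_lt_rev.2 hab

theorem choose_le_card_toFinset_crossings {w : List (Fin n)}
    (h : wordProd w = longestElement n) :
    (n + 1).choose 2 ≤ (crossings 1 w).toFinset.card := by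
  have h1 := Sym2.card_subtype_not_diag (α := Fin (n + 1))
  rw [Fintype.card_fin, Fintype.card_subtype] at h1
  rw [← h1]
  refine Finset.card_le_card fun e he => ?_
  rw [List.mem_toFinset]
  exact mem_crossings_longestElement h (by simpa using he)

theorem permLength_longestElement (m : ℕ) :
    permLength (longestElement (m + 1)) = (m + 2).choose 2 := by
  have hmem := length_gcWord m fun _ => .A
  refine le_antisymm (Nat.sInf_le ⟨_, wordProd_gcWord m _, hmem⟩)
    (le_csInf ⟨_, _, wordProd_gcWord m _, hmem⟩ ?_)
  rintro r ⟨w, hw, rfl⟩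
  rw [← length_crossings 1 w]
  exact (choose_le_card_toFinset_crossings hw).trans (List.toFinset_card_le _)

theorem isReducedWord_longestElement_iff {m : ℕ} {w : List (Fin (m + 1))} :
    IsReducedWord w (longestElement (m + 1)) ↔
      wordProd w = longestElement (m + 1) ∧ w.length = (m + 2).choose 2 := by
  rw [IsReducedWord, permLength_longestElement]

/-- In the wiring diagram of a reduced word of the longest element no pair of wires crosses twice:
there are as many letters as pairs, and every pair has to cross. -/
theorem nodup_crossings {m : ℕ} {w : List (Fin (m + 1))}
    (h : IsReducedWord w (longestElement (m + 1))) : (crossings 1 w).Nodup := by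
  rw [isReducedWord_longestElement_iff] at h
  have h1 := choose_le_card_toFinset_crossings h.1
  rw [← h.2, ← length_crossings 1 w] at h1
  rw [← Multiset.coe_nodup, ← Multiset.toFinset_card_eq_card_iff_nodup]
  exact le_antisymm (List.toFinset_card_le _) h1

end

/-! ### The path of the smallest wire -/

section

variable {n : ℕ}

/-- The positions `q 0 < q 1 < ⋯` carry the letters `0, 1, …`, and any other position `s` is, on its
side of the position `q i` with the same letter `i`, also beyond the neighbouring position
`q (i - 1)`, respectively `q (i + 1)`. In the wiring diagram, `q` lists the crossings of
wire `0`. -/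
structure IsAscendingRun (w : List (Fin n)) (q : Fin n → Fin w.length) : Prop where
  strictMono : StrictMono q
  get_eq : ∀ k, w.get (q k) = k
  exists_lt : ∀ s, s < q (w.get s) → ∃ k : Fin n, (k : ℕ) + 1 = w.get s ∧ s < q k
  exists_gt : ∀ s, q (w.get s) < s → ∃ k : Fin n, (k : ℕ) = w.get s + 1 ∧ q k < s

/-- The position of wire `0` after the first `t` letters of `w`. -/
def wirePos (w : List (Fin n)) (t : ℕ) : ℕ :=
  ((wordProd (w.take t))⁻¹ 0 : Fin (n + 1))

theorem wordProd_take_succ (w : List (Fin n)) (t : Fin w.length) :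
    wordProd (w.take (t + 1)) = wordProd (w.take t) * simpleTransposition (w.get t) := by
  rw [List.take_succ_eq_append_getElem t.2, wordProd_append, wordProd_cons, wordProd_nil, mul_one]
  rfl

/-- In a reduced word of the longest element wire `0` never moves to the left: the wire it would
cross had already crossed it. -/
theorem get_add_one_ne_wirePos {m : ℕ} {w : List (Fin (m + 1))}
    (h : IsReducedWord w (longestElement (m + 1))) (t : Fin w.length) :
    (w.get t : ℕ) + 1 ≠ wirePos w t := by
  intro ht
  set π := wordProd (w.take t) with hπ
  have h0 : π⁻¹ 0 = (w.get t).succ := Fin.ext (by rw [Fin.val_succ]; exact ht.symm)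
  set b := π (w.get t).castSucc with hb
  have hb' : π⁻¹ b = (w.get t).castSucc := by simp [hb]
  have h1 : π (w.get t).succ = 0 := by rw [← h0]; simp
  have hb0 : b ≠ 0 := fun e => by
    have : (w.get t).castSucc = (w.get t).succ := π.injective (by rw [h1, ← hb, e])
    simp [Fin.ext_iff] at this
  have hmem : s(0, b) ∈ crossings 1 (w.take t) := by
    refine mem_crossings ?_ ?_
    · simpa using Fin.pos_iff_ne_zero.2 hb0
    · rw [one_mul, ← hπ, h0, hb']
      exact Fin.castSucc_lt_succ
  have hsplit : w = w.take t ++ w.get t :: w.drop (t + 1) := by simp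
  have hnd := nodup_crossings h
  rw [hsplit, crossings_append, crossings, one_mul, ← hπ, ← hb, h1, List.nodup_append] at hnd
  exact hnd.2.2 _ hmem _ List.mem_cons_self Sym2.eq_swap

theorem wirePos_succ {m : ℕ} {w : List (Fin (m + 1))}
    (h : IsReducedWord w (longestElement (m + 1))) (t : Fin w.length) :
    wirePos w (t + 1) = if (w.get t : ℕ) = wirePos w t then wirePos w t + 1 else wirePos w t := by
  have hne := get_add_one_ne_wirePos h t
  have hs : (simpleTransposition (w.get t))⁻¹ = simpleTransposition (w.get t) := Equiv.swap_inv _ _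
  rw [wirePos, wordProd_take_succ, mul_inv_rev, hs, Equiv.Perm.mul_apply]
  rw [wirePos] at hne ⊢
  generalize (wordProd (w.take t))⁻¹ 0 = x at *
  rw [simpleTransposition, Equiv.swap_apply_def]
  simp only [Fin.ext_iff, Fin.val_castSucc, Fin.val_succ]
  split_ifs <;> simp_all

theorem exists_isAscendingRun {m : ℕ} {w : List (Fin (m + 1))}
    (h : IsReducedWord w (longestElement (m + 1))) : ∃ q, IsAscendingRun w q := by
  have h0 : wirePos w 0 = 0 := by simp [wirePos, wordProd_nil]
  have hL : wirePos w w.length = m + 1 := by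
    rw [wirePos, List.take_length, h.1]
    rfl
  have hstep := wirePos_succ h
  have hne := get_add_one_ne_wirePos h
  generalize wirePos w = p at *
  have hsucc : ∀ t, t < w.length → p t ≤ p (t + 1) ∧ p (t + 1) ≤ p t + 1 := fun t ht => by
    have := hstep ⟨t, ht⟩
    simp only at this
    split_ifs at this <;> omega
  have hmono : ∀ s t, s ≤ t → t ≤ w.length → p s ≤ p t := fun s t hst => by
    induction t, hst using Nat.le_induction with
    | base => exact fun _ => le_rfl
    | succ t _ ih => exact fun ht => (ih (by omega)).trans (hsucc t (by omega)).1
  have hpos : 0 < w.length := by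
    rcases Nat.eq_zero_or_pos w.length with e | e
    · rw [e, h0] at hL; omega
    · exact e
  have hex : ∀ k : Fin (m + 1), ∃ t : Fin w.length, p t = k ∧ p (t + 1) = k + 1 := fun k => by
    -- The step at which wire `0` first gets beyond position `k`.
    classical
    have hne : ∃ t, (k : ℕ) < p (t + 1) :=
      ⟨w.length - 1, by rw [Nat.sub_add_cancel hpos, hL]; exact k.2⟩
    have hlt : Nat.find hne < w.length := by
      have : Nat.find hne ≤ w.length - 1 :=
        Nat.find_min' hne (by rw [Nat.sub_add_cancel hpos, hL]; exact k.2)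
      omega
    have h1 := Nat.find_spec hne
    have h2 : p (Nat.find hne) ≤ k := by
      rcases hf : Nat.find hne with _ | t
      · rw [h0]; exact Nat.zero_le _
      · exact not_lt.1 (Nat.find_min hne (by omega))
    have h3 := hsucc _ hlt
    exact ⟨⟨_, hlt⟩, by simp only; omega, by simp only; omega⟩
  choose q hq hq' using hex
  have hget : ∀ k, w.get (q k) = k := fun k => by
    have := hstep (q k)
    rw [hq, hq'] at this
    split_ifs at this with e
    · exact Fin.ext e
    · omega
  have hlt : ∀ (k : Fin (m + 1)) (s : Fin w.length), p s ≤ k → s ≤ q k := fun k s hs => by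
    by_contra hc
    have := hmono (q k + 1) s (by simpa using hc) s.2.le
    rw [hq'] at this
    omega
  have hgt : ∀ (k : Fin (m + 1)) (s : Fin w.length), (k : ℕ) < p s → q k < s := fun k s hs => by
    by_contra hc
    have := hmono s (q k) (by simpa using hc) (q k).2.le
    rw [hq] at this
    omega
  refine ⟨q, fun a b hab => hgt _ _ (by rw [hq]; exact hab), hget, fun s hs => ?_, fun s hs => ?_⟩
  · have h1 := hmono (s + 1) (q (w.get s)) (by simpa using hs) (q (w.get s)).2.le
    have h2 := hstep s
    have h3 := hsucc s s.2
    rw [hq] at h1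
    have h4 : p s < w.get s := by split_ifs at h2 <;> omega
    have hk : (w.get s : ℕ) - 1 < m + 1 := by have := (w.get s).2; omega
    refine ⟨⟨w.get s - 1, hk⟩, by simp only; omega, lt_of_le_of_ne (hlt _ _ ?_) ?_⟩
    · simp only; omega
    · intro e
      have := congrArg (fun k : Fin (m + 1) => (k : ℕ)) (hget ⟨w.get s - 1, hk⟩)
      rw [← e] at this
      simp only at this
      omega
  · have h1 := hmono (q (w.get s) + 1) s (by simpa using hs) s.2.le
    have h2 := hne s
    have h3 := hmono s w.length s.2.le le_rfl
    rw [hq'] at h1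
    refine ⟨⟨w.get s + 1, by omega⟩, rfl, hgt _ _ ?_⟩
    simp only
    omega

end

/-! ### Isomorphisms of word posets -/

section

variable {n : ℕ}

/-- Isomorphism of word posets: an order isomorphism that preserves columns. -/
def WordPoset.IsIso (P Q : WordPoset) : Prop :=
  ∃ e : P.Carrier ≃o Q.Carrier, ∀ x, Q.col (e x) = P.col x

namespace WordPoset

theorem IsIso.symm {P Q : WordPoset} (h : P.IsIso Q) : Q.IsIso P := by
  obtain ⟨e, he⟩ := h
  exact ⟨e.symm, fun x => by rw [← he, e.apply_symm_apply]⟩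

theorem IsIso.trans {P Q R : WordPoset} (h : P.IsIso Q) (h' : Q.IsIso R) : P.IsIso R := by
  obtain ⟨e, he⟩ := h
  obtain ⟨f, hf⟩ := h'
  exact ⟨e.trans f, fun x => by rw [OrderIso.trans_apply, hf, he]⟩

theorem apply_mem_chain {P Q : WordPoset} (e : P.Carrier ≃o Q.Carrier)
    (he : ∀ x, Q.col (e x) = P.col x) {m : ℕ} {δ : Dir} {x : P.Carrier} (hx : x ∈ P.chain m δ) :
    e x ∈ Q.chain m δ := by
  obtain ⟨c, hc, hcol, i, rfl⟩ := hx
  exact ⟨fun i => e (c i), e.strictMono.comp hc, fun i => by rw [he, hcol], i, rfl⟩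

theorem apply_mem_chain_iff {P Q : WordPoset} (e : P.Carrier ≃o Q.Carrier)
    (he : ∀ x, Q.col (e x) = P.col x) {m : ℕ} {δ : Dir} {x : P.Carrier} :
    e x ∈ Q.chain m δ ↔ x ∈ P.chain m δ := by
  refine ⟨fun h => ?_, apply_mem_chain e he⟩
  have := apply_mem_chain e.symm (fun y => by rw [← he, e.apply_symm_apply]) h
  rwa [e.symm_apply_apply] at this

theorem apply_mem_contractionIdeal_iff {P Q : WordPoset} (e : P.Carrier ≃o Q.Carrier)
    (he : ∀ x, Q.col (e x) = P.col x) {m : ℕ} {δ : Dir} {x : P.Carrier} :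
    e x ∈ Q.contractionIdeal m δ ↔ x ∈ P.contractionIdeal m δ := by
  constructor
  · rintro ⟨c, hc, hlt, hcol⟩
    obtain ⟨c, rfl⟩ := e.surjective c
    exact ⟨c, (apply_mem_chain_iff e he).1 hc, e.lt_iff_lt.1 hlt, by rwa [he, he] at hcol⟩
  · rintro ⟨c, hc, hlt, hcol⟩
    exact ⟨e c, apply_mem_chain e he hc, e.lt_iff_lt.2 hlt, by rwa [he, he]⟩

theorem IsIso.index_eq {P Q : WordPoset} (h : P.IsIso Q) (m : ℕ) (δ : Dir) :
    P.index m δ = Q.index m δ := by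
  obtain ⟨e, he⟩ := h
  rw [index, index, ← Set.ncard_image_of_injective _ e.injective]
  congr 1
  ext y
  obtain ⟨x, rfl⟩ := e.surjective y
  rw [e.injective.mem_set_image]
  constructor
  · rintro ⟨c, hc, hlt, hcol⟩
    exact ⟨e c, apply_mem_chain e he hc, e.lt_iff_lt.2 hlt, by rwa [he, he]⟩
  · rintro ⟨c, hc, hlt, hcol⟩
    obtain ⟨c, rfl⟩ := e.surjective c
    exact ⟨c, (apply_mem_chain_iff e he).1 hc, e.lt_iff_lt.1 hlt, by rwa [he, he] at hcol⟩

open Classical in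
theorem IsIso.contract {P Q : WordPoset} (h : P.IsIso Q) (m : ℕ) (δ : Dir) :
    (P.contract m δ).IsIso (Q.contract m δ) := by
  obtain ⟨e, he⟩ := h
  refine ⟨⟨e.toEquiv.subtypeEquiv fun x => (apply_mem_chain_iff e he).not.symm, ?_⟩, ?_⟩
  · intro a b
    exact e.le_iff_le
  · rintro ⟨x, hx⟩
    cases δ
    · show (if e x ∈ _ then Q.col (e x) - 1 else Q.col (e x)) =
        if x ∈ _ then P.col x - 1 else P.col x
      simp only [apply_mem_contractionIdeal_iff e he, he]
    · show (if e x ∈ _ then Q.col (e x) else Q.col (e x) - 1) =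
        if x ∈ _ then P.col x else P.col x - 1
      simp only [apply_mem_contractionIdeal_iff e he, he]

theorem IsIso.deltaIndex_eq {P Q : WordPoset} (h : P.IsIso Q) (m : ℕ) (δ : Fin m → Dir) :
    deltaIndex m δ P = deltaIndex m δ Q := by
  induction m generalizing P Q with
  | zero => rfl
  | succ m ih => rw [deltaIndex, deltaIndex, h.index_eq, ih (h.contract _ _)]

theorem deltaIndex_succ_eq_zero_iff {m : ℕ} {δ : Fin (m + 1) → Dir} {P : WordPoset} :
    deltaIndex (m + 1) δ P = 0 ↔ P.index (m + 2) (δ (Fin.last m)) = 0 ∧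
      deltaIndex m (Fin.init δ) (P.contract (m + 2) (δ (Fin.last m))) = 0 := by
  rw [deltaIndex]
  constructor
  · intro h
    refine ⟨by simpa using congrFun h (Fin.last m), funext fun i => ?_⟩
    simpa using congrFun h i.castSucc
  · rintro ⟨h1, h2⟩
    funext i
    cases i using Fin.lastCases with
    | last => simpa using h1
    | cast i => simpa using congrFun h2 i

/-! ### The mirror image of a word poset -/

/-- The word poset with the same order and the columns reversed by `c ↦ M - c`. It exchanges
ascending and descending chains of a word poset with columns `1, …, M - 1`. -/
def mirror (M : ℕ) (P : WordPoset) : WordPoset where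
  Carrier := P.Carrier
  order := P.order
  col := fun x => M - P.col x

theorem mirror_col_eq {m : ℕ} {P : WordPoset} (hP : ∀ x, 1 ≤ P.col x ∧ P.col x ≤ m) (δ : Dir)
    (i : Fin m) (x : P.Carrier) :
    (P.mirror (m + 1)).col x = δ.flip.chainCol m i ↔ P.col x = δ.chainCol m i := by
  have := hP x
  cases δ <;> simp only [mirror, Dir.chainCol, Dir.flip] <;> omega

theorem chain_mirror {m : ℕ} {P : WordPoset} (hP : ∀ x, 1 ≤ P.col x ∧ P.col x ≤ m) (δ : Dir) :
    (P.mirror (m + 1)).chain m δ.flip = P.chain m δ := by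
  ext x
  exact exists_congr fun c => and_congr Iff.rfl
    (and_congr (forall_congr' fun i => mirror_col_eq hP δ i (c i)) Iff.rfl)

theorem mirror_col_inj {m : ℕ} {P : WordPoset} (hP : ∀ x, 1 ≤ P.col x ∧ P.col x ≤ m)
    (x y : P.Carrier) :
    (P.mirror (m + 1)).col x = (P.mirror (m + 1)).col y ↔ P.col x = P.col y := by
  have := hP x
  have := hP y
  simp only [mirror]
  omega

theorem index_mirror {m : ℕ} {P : WordPoset} (hP : ∀ x, 1 ≤ P.col x ∧ P.col x ≤ m) (δ : Dir) :
    (P.mirror (m + 1)).index m δ.flip = P.index m δ := by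
  rw [index, index, chain_mirror hP]
  congr 1
  ext x
  exact exists_congr fun c => and_congr Iff.rfl (and_congr Iff.rfl (mirror_col_inj hP _ _))

theorem contractionIdeal_mirror {m : ℕ} {P : WordPoset} (hP : ∀ x, 1 ≤ P.col x ∧ P.col x ≤ m)
    (δ : Dir) : (P.mirror (m + 1)).contractionIdeal m δ.flip = P.contractionIdeal m δ := by
  rw [contractionIdeal, contractionIdeal, chain_mirror hP]
  ext x
  exact exists_congr fun c => and_congr Iff.rfl (and_congr Iff.rfl (mirror_col_inj hP _ _))

open Classical in
theorem contract_mirror {m : ℕ} {P : WordPoset} (hP : ∀ x, 1 ≤ P.col x ∧ P.col x ≤ m)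
    (δ : Dir) :
    ((P.contract m δ).mirror m).IsIso ((P.mirror (m + 1)).contract m δ.flip) := by
  refine ⟨⟨Equiv.subtypeEquivRight fun x => by rw [chain_mirror hP]; rfl, Iff.rfl⟩, ?_⟩
  rintro ⟨x, hx⟩
  obtain ⟨h1, h2⟩ := hP x
  have hid : x ∈ (P.mirror (m + 1)).contractionIdeal m δ.flip ↔ x ∈ P.contractionIdeal m δ := by
    rw [contractionIdeal_mirror hP]
    rfl
  have key : ∀ (c : ℕ) (p q : Prop), (p ↔ q) → 1 ≤ c → c ≤ m →
      ((if p then m + 1 - c else m + 1 - c - 1) = m - if q then c - 1 else c) ∧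
        (if p then m + 1 - c - 1 else m + 1 - c) = m - if q then c else c - 1 := by
    intro c p q hpq hc hc'
    by_cases hq : q <;> simp only [hpq, hq, if_true, if_false] <;> omega
  cases δ
  · exact (key (P.col x) _ _ hid h1 h2).1
  · exact (key (P.col x) _ _ hid h1 h2).2

theorem mirror_mirror {m : ℕ} {P : WordPoset} (hP : ∀ x, P.col x ≤ m) :
    ((P.mirror m).mirror m).IsIso P :=
  ⟨OrderIso.refl _, fun x => (Nat.sub_sub_self (hP x)).symm⟩

theorem IsIso.mirror {P Q : WordPoset} (h : P.IsIso Q) (m : ℕ) :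
    (P.mirror m).IsIso (Q.mirror m) := by
  obtain ⟨e, he⟩ := h
  exact ⟨e, fun x => congrArg (m - ·) (he x)⟩

end WordPoset

/-! ### Chains and contractions of word posets of words -/

theorem wordPoset_col_bounds (w : List (Fin n)) (x : (wordPoset w).Carrier) :
    1 ≤ (wordPoset w).col x ∧ (wordPoset w).col x ≤ n := by
  have : (w.get x : ℕ) < n := (w.get x).2
  simp only [wordPoset]
  omega

theorem lt_of_wordPoset_lt {w : List (Fin n)} {x y : (wordPoset w).Carrier} (h : x < y) :
    @LT.lt (Fin w.length) _ x y :=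
  lt_of_le_of_ne (le_of_reflTransGen_wordRel w h.1) fun e => lt_irrefl x (by rwa [← e] at h)

theorem wordPoset_lt_of_wordRel {w : List (Fin n)} {x y : Fin w.length} (h : wordRel w x y) :
    @LT.lt (wordPoset w).Carrier _ x y :=
  ⟨.single h, fun h' => absurd (le_of_reflTransGen_wordRel w h') (not_le.2 h.1)⟩

theorem wordPoset_map_rev (w : List (Fin n)) :
    (wordPoset (w.map Fin.rev)).IsIso ((wordPoset w).mirror (n + 1)) := by
  have hlen : (w.map Fin.rev).length = w.length := List.length_map _
  have hget : ∀ x : Fin (w.map Fin.rev).length,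
      ((w.map Fin.rev).get x : ℕ) = n - (w.get (x.cast hlen) + 1) := fun x => by
    simp [Fin.val_rev]
  have hrel : ∀ x y, wordRel (w.map Fin.rev) x y ↔ wordRel w (x.cast hlen) (y.cast hlen) := by
    intro x y
    refine and_congr Iff.rfl ?_
    have h1 := (w.get (x.cast hlen)).2
    have h2 := (w.get (y.cast hlen)).2
    rw [hget, hget]
    omega
  refine ⟨⟨finCongr hlen, ?_⟩, fun x => ?_⟩
  · intro a b
    refine ⟨fun h => ?_, fun h => ?_⟩
    · exact Relation.ReflTransGen.lift (p := wordRel (w.map Fin.rev)) (Fin.cast hlen.symm)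
        (fun x y hxy => (hrel _ _).2 hxy) _ _ h
    · exact Relation.ReflTransGen.lift (p := wordRel w) (Fin.cast hlen)
        (fun x y hxy => (hrel _ _).1 hxy) _ _ h
  · have h1 := (w.get (Fin.cast hlen x)).2
    have key : ∀ a : ℕ, a < n → n + 1 - (a + 1) = n - (a + 1) + 1 := by omega
    exact (key _ h1).trans (congrArg (· + 1) (hget x).symm)

end

section

variable {m : ℕ}

namespace IsAscendingRun

variable {w : List (Fin (m + 1))} {q : Fin (m + 1) → Fin w.length}

/-- The ascending chain is unique: `exists_lt` shows upwards that it is nowhere before `q`, and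
`exists_gt` shows downwards that it is nowhere after `q`. -/
theorem eq_of_strictMono (h : IsAscendingRun w q) {c : Fin (m + 1) → Fin w.length}
    (hc : StrictMono c) (hget : ∀ i, w.get (c i) = i) : c = q := by
  have h1 : ∀ (k : ℕ) (hk : k < m + 1), q ⟨k, hk⟩ ≤ c ⟨k, hk⟩ := by
    intro k
    induction k with
    | zero =>
      intro hk
      by_contra hlt
      obtain ⟨k', hk', -⟩ := h.exists_lt (c ⟨0, hk⟩) (by rw [hget]; exact not_le.1 hlt)
      rw [hget] at hk'
      simp at hk'
    | succ k ih =>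
      intro hk
      by_contra hlt
      obtain ⟨k', hk', hs⟩ := h.exists_lt (c ⟨k + 1, hk⟩) (by rw [hget]; exact not_le.1 hlt)
      rw [hget] at hk'
      rw [show k' = ⟨k, by omega⟩ from Fin.ext (by simpa using hk')] at hs
      have := hc (show (⟨k, by omega⟩ : Fin (m + 1)) < ⟨k + 1, hk⟩ from Nat.lt_succ_self k)
      exact absurd (hs.trans_le (ih _)) this.asymm
  have h2 : ∀ (d k : ℕ) (hk : k < m + 1), k + d = m → c ⟨k, hk⟩ ≤ q ⟨k, hk⟩ := by
    intro d
    induction d with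
    | zero =>
      intro k hk hkd
      by_contra hlt
      obtain ⟨k', hk', -⟩ := h.exists_gt (c ⟨k, hk⟩) (by rw [hget]; exact not_le.1 hlt)
      rw [hget] at hk'
      have := k'.2
      simp only at hk'
      omega
    | succ d ih =>
      intro k hk hkd
      by_contra hlt
      obtain ⟨k', hk', hs⟩ := h.exists_gt (c ⟨k, hk⟩) (by rw [hget]; exact not_le.1 hlt)
      rw [hget] at hk'
      rw [show k' = ⟨k + 1, by omega⟩ from Fin.ext (by simpa using hk')] at hs
      have := hc (show (⟨k, hk⟩ : Fin (m + 1)) < ⟨k + 1, by omega⟩ from Nat.lt_succ_self k)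
      exact absurd ((ih (k + 1) _ (by omega)).trans_lt hs) this.asymm
  funext k
  exact le_antisymm (h2 (m - k) k k.2 (by omega)) (h1 k k.2)

theorem chain_eq (h : IsAscendingRun w q) :
    (wordPoset w).chain (m + 1) .A = Set.range (α := Fin w.length) q := by
  ext x
  constructor
  · rintro ⟨c, hc, hcol, hx⟩
    have : c = q := h.eq_of_strictMono (c := c)
      (fun i j hij => lt_of_wordPoset_lt (hc hij)) fun i => Fin.ext (Nat.succ_injective (hcol i))
    rwa [this] at hx
  · intro hx
    refine ⟨q, Fin.strictMono_iff_lt_succ.2 fun i => ?_, fun i => ?_, hx⟩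
    · refine wordPoset_lt_of_wordRel ⟨h.strictMono Fin.castSucc_lt_succ, Or.inl ?_⟩
      rw [h.get_eq, h.get_eq]
      rfl
    · exact congrArg (fun k : Fin (m + 1) => (k : ℕ) + 1) (h.get_eq i)

theorem wordPoset_lt_of_lt (h : IsAscendingRun w q) {s : Fin w.length} (hs : s < q (w.get s)) :
    @LT.lt (wordPoset w).Carrier _ s (q (w.get s)) := by
  obtain ⟨k, hk, hsk⟩ := h.exists_lt s hs
  refine (wordPoset_lt_of_wordRel (x := s) (y := q k) ⟨hsk, Or.inr ?_⟩).trans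
    (wordPoset_lt_of_wordRel (x := q k) ⟨h.strictMono ?_, Or.inl ?_⟩)
  · rw [h.get_eq, hk]
  · rw [Fin.lt_def]; omega
  · rw [h.get_eq, h.get_eq, hk]

theorem wordPoset_lt_of_gt (h : IsAscendingRun w q) {s : Fin w.length} (hs : q (w.get s) < s) :
    @LT.lt (wordPoset w).Carrier _ (q (w.get s)) s := by
  obtain ⟨k, hk, hsk⟩ := h.exists_gt s hs
  refine (wordPoset_lt_of_wordRel (x := q (w.get s)) (y := q k) ⟨h.strictMono ?_, Or.inl ?_⟩).trans
    (wordPoset_lt_of_wordRel (x := q k) (y := s) ⟨hsk, Or.inr ?_⟩)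
  · rw [Fin.lt_def]; omega
  · rw [h.get_eq, h.get_eq, hk]
  · rw [h.get_eq, hk]

theorem index_eq_zero_iff (h : IsAscendingRun w q) :
    (wordPoset w).index (m + 1) .A = 0 ↔ ∀ s, s ≤ q (w.get s) := by
  have hfin : Finite (wordPoset w).Carrier := inferInstanceAs (Finite (Fin w.length))
  rw [WordPoset.index, Set.ncard_eq_zero (Set.toFinite _), Set.eq_empty_iff_forall_notMem,
    h.chain_eq]
  constructor
  · intro hs s
    by_contra hlt
    refine hs s ⟨q (w.get s), ⟨_, rfl⟩, h.wordPoset_lt_of_gt (not_le.1 hlt), ?_⟩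
    exact congrArg (fun k : Fin (m + 1) => (k : ℕ) + 1) (h.get_eq (w.get s)).symm
  · rintro hs s ⟨_, ⟨k, rfl⟩, hlt, hcol⟩
    have hk : w.get s = k := by
      rw [← h.get_eq k]
      exact Fin.ext (Nat.succ_injective hcol)
    have := hs s
    rw [hk] at this
    exact absurd (lt_of_wordPoset_lt hlt) (not_lt.2 this)

end IsAscendingRun

/-- If the positions of a subword form a lower set, the order of its word poset (with all letters
lowered by one) is the induced order. -/
theorem reflTransGen_wordRel_iff {n n' : ℕ} {w : List (Fin n)} {v : List (Fin n')}
    {f : Fin v.length → Fin w.length} (hf : StrictMono f)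
    (hget : ∀ a, (w.get (f a) : ℕ) = v.get a + 1)
    (hdown : ∀ x y, wordRel w x y → y ∈ Set.range f → x ∈ Set.range f) {a b : Fin v.length} :
    Relation.ReflTransGen (wordRel w) (f a) (f b) ↔ Relation.ReflTransGen (wordRel v) a b := by
  have hrel : ∀ a b, wordRel w (f a) (f b) ↔ wordRel v a b := fun a b => by
    rw [wordRel, wordRel, hf.lt_iff_lt, hget, hget]
    omega
  refine ⟨fun h => ?_, fun h => Relation.ReflTransGen.lift f (fun x y => (hrel x y).2) _ _ h⟩
  suffices ∀ y, Relation.ReflTransGen (wordRel w) (f a) y → ∀ b, f b = y →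
      Relation.ReflTransGen (wordRel v) a b from this _ h b rfl
  intro y hy
  induction hy with
  | refl => intro b hb; rw [hf.injective hb]
  | tail _ hxy ih =>
    rintro b rfl
    obtain ⟨c, rfl⟩ := hdown _ _ hxy ⟨b, rfl⟩
    exact (ih c rfl).tail ((hrel _ _).1 hxy)

/-- The subword on `{j, j + 1}` can be read off from any list of all positions in which the
positions of these two letters are sorted. -/
theorem filter_map_val_eq_of_sorted {w : List (Fin (m + 1))} {σ : List (Fin w.length)}
    (j : ℕ)
    (hsorted : (σ.filter fun s => (w.get s : ℕ) = j ∨ (w.get s : ℕ) = j + 1).SortedLT)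
    (hmem : ∀ s, s ∈ σ) :
    adjFilter j (w.map Fin.val) = adjFilter j (σ.map fun s => (w.get s : ℕ)) := by
  have hw : w.map Fin.val = (List.finRange w.length).map fun s => (w.get s : ℕ) := by
    conv_lhs => rw [← List.map_get_finRange w, List.map_map]
    rfl
  rw [hw, adjFilter, adjFilter, List.filter_map, List.filter_map]
  congr 1
  refine List.SortedLT.eq_of_mem_iff ?_ hsorted fun s => ?_
  · exact ((List.sortedLT_finRange _).pairwise.filter _).sortedLT
  · simp [hmem]

/-- If nothing lies above the ascending chain, the contraction is the word poset of the word `v`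
left after deleting the chain, and the chain can be moved to the end of the word. -/
theorem IsAscendingRun.exists_contract {w : List (Fin (m + 2))} {q : Fin (m + 2) → Fin w.length}
    (h : IsAscendingRun w q) (hmax : ∀ s, s ≤ q (w.get s)) :
    ∃ v : List (Fin (m + 1)), (wordPoset v).IsIso ((wordPoset w).contract (m + 2) .A) ∧
      TraceEq (w.map Fin.val) ((appendChain .A v).map Fin.val) := by
  classical
  have hlt : ∀ s, s ∉ Set.range q → s < q (w.get s) := fun s hs =>
    lt_of_le_of_ne (hmax s) fun e => hs ⟨_, e.symm⟩
  set σ : List (Fin w.length) := (List.finRange w.length).filter (· ∉ Set.range q) with hσ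
  have hσmem : ∀ s, s ∈ σ ↔ s ∉ Set.range q := fun s => by simp [hσ]
  have hσsort : σ.SortedLT := ((List.sortedLT_finRange _).pairwise.filter _).sortedLT
  -- The letter `0` occurs only in the chain, so the remaining letters can be lowered.
  have hne : ∀ s ∈ σ, w.get s ≠ 0 := fun s hs e => by
    obtain ⟨k, hk, -⟩ := h.exists_lt s (hlt s ((hσmem s).1 hs))
    rw [e] at hk
    simp at hk
  obtain ⟨v, hv⟩ : ∃ v : List (Fin (m + 1)), v.map Fin.succ = σ.map w.get := by
    have : σ.map w.get ∈ Set.range (List.map (Fin.succ (n := m + 1))) := by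
      rw [Set.range_list_map]
      intro x hx
      obtain ⟨s, hs, rfl⟩ := List.mem_map.1 hx
      exact ⟨_, Fin.succ_pred _ (hne s hs)⟩
    exact this
  have hlen : v.length = σ.length := by simpa using congrArg List.length hv
  set f : Fin v.length → Fin w.length := fun a => σ.get (a.cast hlen) with hfdef
  have hf : StrictMono f := fun a b hab => hσsort.strictMono_get hab
  have hfrange : ∀ s, s ∈ Set.range f ↔ s ∉ Set.range q := fun s => by
    rw [← hσmem, List.mem_iff_get]
    constructor
    · rintro ⟨a, rfl⟩; exact ⟨_, rfl⟩
    · rintro ⟨a, rfl⟩; exact ⟨a.cast hlen.symm, rfl⟩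
  have hget : ∀ a, w.get (f a) = (v.get a).succ := fun a => by
    have := List.getElem_of_eq hv (i := a) (by simp)
    simpa [hfdef] using this.symm
  refine ⟨v, ⟨⟨Equiv.ofBijective (fun a => ⟨f a, ?_⟩) ⟨?_, ?_⟩, ?_⟩, ?_⟩, ?_⟩
  · rw [h.chain_eq]; exact (hfrange _).1 ⟨a, rfl⟩
  · intro a b hab
    exact hf.injective (congrArg Subtype.val hab)
  · rintro ⟨s, hs⟩
    rw [h.chain_eq] at hs
    obtain ⟨a, rfl⟩ := (hfrange _).2 hs
    exact ⟨a, rfl⟩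
  · intro a b
    refine reflTransGen_wordRel_iff hf (fun a => by rw [hget]; rfl) ?_
    intro x y hxy hy
    rw [hfrange] at hy ⊢
    rintro ⟨k, rfl⟩
    have hylt := hlt y hy
    rw [wordRel, h.get_eq] at hxy
    rcases hxy with ⟨hky, hadj | hadj⟩
    · obtain ⟨k', hk', hyk⟩ := h.exists_lt y hylt
      obtain rfl : k' = k := Fin.ext (by omega)
      exact hky.asymm hyk
    · have := h.strictMono (show w.get y < k by rw [Fin.lt_def]; omega)
      exact absurd (hky.trans hylt) this.asymm
  · intro a
    have hid : @Membership.mem (wordPoset w).Carrier _ _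
        ((wordPoset w).contractionIdeal (m + 2) .A) (f a) := by
      refine ⟨q (w.get (f a)), by rw [h.chain_eq]; exact ⟨_, rfl⟩,
        h.wordPoset_lt_of_lt (hlt _ ((hfrange _).1 ⟨a, rfl⟩)), ?_⟩
      exact congrArg (fun k : Fin (m + 2) => (k : ℕ) + 1) (h.get_eq _).symm
    refine (if_pos hid).trans ?_
    exact congrArg (fun k : Fin (m + 2) => (k : ℕ) + 1 - 1) (hget a)
  · have hmap : (appendChain .A v).map Fin.val =
        (σ ++ (List.finRange (m + 2)).map q).map fun s => (w.get s : ℕ) := by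
      rw [appendChain, hv, List.map_append, List.map_append, List.map_map, List.map_map]
      congr 1
      refine List.map_congr_left fun k _ => ?_
      simp only [Function.comp, h.get_eq]
    intro j
    rw [hmap]
    refine filter_map_val_eq_of_sorted j ?_ fun s => ?_
    · rw [List.filter_append]
      refine List.Pairwise.sortedLT (List.pairwise_append.2 ⟨hσsort.pairwise.filter _, ?_, ?_⟩)
      · exact (((List.sortedLT_finRange _).pairwise.map q fun a b hab =>
          h.strictMono hab).filter _)
      · intro s hs t ht
        simp only [List.mem_filter, decide_eq_true_eq] at hs ht
        obtain ⟨hs, hsj⟩ := hs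
        obtain ⟨ht, htj⟩ := ht
        obtain ⟨k, -, rfl⟩ := List.mem_map.1 ht
        rw [h.get_eq] at htj
        have hsq := hlt s ((hσmem s).1 hs)
        rcases lt_trichotomy (w.get s : ℕ) k with e | e | e
        · exact hsq.trans (h.strictMono e)
        · rwa [Fin.ext e] at hsq
        · obtain ⟨k', hk', hyk⟩ := h.exists_lt s hsq
          rwa [show k = k' from Fin.ext (by omega)]
    · rw [List.mem_append, hσmem, List.mem_map]
      by_cases hs : s ∈ Set.range q
      · right
        obtain ⟨k, rfl⟩ := hs
        exact ⟨k, List.mem_finRange k, rfl⟩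
      · exact Or.inl hs

end

section

variable {m n : ℕ}

/-! ### Words of index zero and their classification -/

theorem adjFilter_eq_nil {j : ℕ} {w : List ℕ} (h : ∀ x ∈ w, x ≠ j ∧ x ≠ j + 1) :
    adjFilter j w = [] := by
  rw [adjFilter, List.filter_eq_nil_iff]
  intro x hx
  have := h x hx
  simp only [decide_eq_true_eq]
  omega

theorem adjFilter_range {j N : ℕ} (h : j + 1 < N) : adjFilter j (List.range N) = [j, j + 1] := by
  induction N, h using Nat.le_induction with
  | base =>
    rw [List.range_succ, List.range_succ, adjFilter_append, adjFilter_append, adjFilter_eq_nil,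
      adjFilter_cons_of_pos _ (Or.inl rfl), adjFilter_cons_of_pos _ (Or.inr rfl)]
    · rfl
    · intro x hx
      have := List.mem_range.1 hx
      omega
  | succ N hN ih =>
    rw [List.range_succ, adjFilter_append, ih, adjFilter_cons_of_neg _ (by omega)]
    rfl

theorem adjFilter_reverse (j : ℕ) (w : List ℕ) :
    adjFilter j w.reverse = (adjFilter j w).reverse :=
  List.filter_reverse ..

theorem map_val_finRange (N : ℕ) : (List.finRange N).map Fin.val = List.range N := by
  simp

theorem map_val_map_succ (w : List (Fin n)) :
    (w.map Fin.succ).map Fin.val = (w.map Fin.val).map (· + 1) := by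
  simp [List.map_map, Function.comp_def]

theorem map_val_map_castSucc (w : List (Fin n)) :
    (w.map Fin.castSucc).map Fin.val = w.map Fin.val := by
  simp [List.map_map, Function.comp_def]

theorem map_val_appendChain_A (w : List (Fin n)) :
    (appendChain .A w).map Fin.val = (w.map Fin.val).map (· + 1) ++ List.range (n + 1) := by
  rw [appendChain, List.map_append, map_val_map_succ, map_val_finRange]

theorem map_val_appendChain_D (w : List (Fin n)) :
    (appendChain .D w).map Fin.val = w.map Fin.val ++ (List.range (n + 1)).reverse := by
  rw [appendChain, List.map_append, map_val_map_castSucc, List.map_reverse, map_val_finRange]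

theorem traceEq_appendChain_iff {d : Dir} {w v : List (Fin n)} :
    TraceEq ((appendChain d w).map Fin.val) ((appendChain d v).map Fin.val) ↔
      TraceEq (w.map Fin.val) (v.map Fin.val) := by
  cases d
  · rw [map_val_appendChain_A, map_val_appendChain_A]
    exact ⟨fun h => traceEq_map_add_one_iff.1 h.of_append_right,
      fun h => (traceEq_map_add_one_iff.2 h).append (.refl _)⟩
  · rw [map_val_appendChain_D, map_val_appendChain_D]
    exact ⟨fun h => h.of_append_right, fun h => h.append (.refl _)⟩

theorem TraceEq.map_rev {w v : List (Fin n)} (h : TraceEq (w.map Fin.val) (v.map Fin.val)) :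
    TraceEq ((w.map Fin.rev).map Fin.val) ((v.map Fin.rev).map Fin.val) := fun j => by
  -- `x ↦ n - (x + 1)` takes at most one letter below `n` to each of `j`, `j + 1`, and these are
  -- adjacent; the bound `x < n` excludes the truncated subtraction.
  have key : ∀ u : List (Fin n), adjFilter j ((u.map Fin.rev).map Fin.val) =
      ((u.map Fin.val).filter fun x => x < n ∧ (n - (x + 1) = j ∨ n - (x + 1) = j + 1)).map
        fun x => n - (x + 1) := fun u => by
    simp only [adjFilter, List.filter_map, List.map_map, Function.comp_def, Fin.val_rev,
      Fin.is_lt, true_and]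
  rw [key, key, h.filter_eq (n - 2 - j)]
  intro x hx
  simp only [decide_eq_true_eq] at hx
  omega

theorem traceEq_map_rev_iff {w v : List (Fin n)} :
    TraceEq ((w.map Fin.rev).map Fin.val) ((v.map Fin.rev).map Fin.val) ↔
      TraceEq (w.map Fin.val) (v.map Fin.val) := by
  refine ⟨fun h => ?_, .map_rev⟩
  have := h.map_rev
  rwa [map_rev_map_rev, map_rev_map_rev] at this

theorem isReducedWord_map_rev {w : List (Fin (m + 1))}
    (h : IsReducedWord w (longestElement (m + 1))) :
    IsReducedWord (w.map Fin.rev) (longestElement (m + 1)) := by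
  rw [isReducedWord_longestElement_iff] at h ⊢
  rwa [wordProd_map_rev_eq_longestElement_iff, List.length_map]

/-- If the subword on `{k, k + 1}` ends in `k + 1`, every `k` is followed by some `k + 1`. -/
theorem exists_gt_of_adjFilter_eq {w : List (Fin n)} {k : ℕ} {B : List ℕ}
    (h : adjFilter k (w.map Fin.val) = B ++ [k, k + 1]) (s : Fin w.length)
    (hs : (w.get s : ℕ) = k) : ∃ t, s < t ∧ (w.get t : ℕ) = k + 1 := by
  have hsplit : w = w.take s ++ w.get s :: w.drop (s + 1) := by simp
  have h2 : B ++ [k] ++ [k + 1] = adjFilter k ((w.take s).map Fin.val) ++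
      k :: adjFilter k ((w.drop (s + 1)).map Fin.val) := by
    conv at h => lhs; rw [hsplit]
    rw [List.map_append, List.map_cons, adjFilter_append, hs,
      adjFilter_cons_of_pos _ (Or.inl rfl)] at h
    rw [h]
    simp
  rcases List.eq_nil_or_concat (adjFilter k ((w.drop (s + 1)).map Fin.val)) with e | ⟨C, c, e⟩
  · rw [e] at h2
    have := (List.append_inj' h2 rfl).2
    simp at this
  · have h3 : B ++ [k] ++ [k + 1] = adjFilter k ((w.take s).map Fin.val) ++ k :: C ++ [c] := by
      rw [h2, e]; simp
    have hc := (List.append_inj' h3 rfl).2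
    simp only [List.cons.injEq, and_true] at hc
    have hmem : c ∈ adjFilter k ((w.drop (s + 1)).map Fin.val) := by rw [e]; simp
    obtain ⟨x, hx, rfl⟩ := List.mem_map.1 (mem_adjFilter.1 hmem).1
    obtain ⟨i, hi, rfl⟩ := List.mem_iff_getElem.1 hx
    rw [List.length_drop] at hi
    refine ⟨⟨s + 1 + i, by omega⟩, ?_, ?_⟩
    · rw [Fin.lt_def]; simp only; omega
    · rw [hc]; simp

/-- In a word equivalent to one ending in `0, 1, …`, nothing lies above the ascending chain: a
letter `k` above the chain would yield a later letter `k + 1` above the chain, and so on. -/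
theorem IsAscendingRun.le_of_traceEq {w : List (Fin (m + 2))} {q : Fin (m + 2) → Fin w.length}
    (h : IsAscendingRun w q) {v : List (Fin (m + 1))}
    (hv : TraceEq (w.map Fin.val) ((appendChain .A v).map Fin.val)) (s : Fin w.length) :
    s ≤ q (w.get s) := by
  suffices ∀ d s, (w.get s : ℕ) + d = m + 1 → ¬ q (w.get s) < s from
    not_lt.1 (this (m + 1 - w.get s) s (by have := (w.get s).2; omega))
  intro d
  induction d with
  | zero =>
    intro s hs hlt
    obtain ⟨k, hk, -⟩ := h.exists_gt s hlt
    have := k.2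
    omega
  | succ d ih =>
    intro s hs hlt
    obtain ⟨k, hk, hks⟩ := h.exists_gt s hlt
    have hfil := hv (w.get s)
    rw [map_val_appendChain_A, adjFilter_append, adjFilter_range (by omega)] at hfil
    obtain ⟨t, hst, ht⟩ := exists_gt_of_adjFilter_eq hfil s rfl
    refine ih t (by omega) ?_
    rw [show w.get t = k from Fin.ext (by omega)]
    exact hks.trans hst

theorem WordPoset.contract_col_le {P : WordPoset} {k : ℕ} {δ : Dir}
    (x : (P.contract k δ).Carrier) : (P.contract k δ).col x ≤ P.col x.1 := by
  cases δ <;> simp only [contract] <;> split_ifs <;> omega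

theorem exists_contract_of_index_eq_zero {w : List (Fin (m + 2))}
    (hw : IsReducedWord w (longestElement (m + 2))) (d : Dir)
    (h : (wordPoset w).index (m + 2) d = 0) :
    ∃ v : List (Fin (m + 1)), (wordPoset v).IsIso ((wordPoset w).contract (m + 2) d) ∧
      TraceEq (w.map Fin.val) ((appendChain d v).map Fin.val) := by
  cases d with
  | A =>
    obtain ⟨q, hq⟩ := exists_isAscendingRun hw
    exact hq.exists_contract (hq.index_eq_zero_iff.1 h)
  | D =>
    obtain ⟨q, hq⟩ := exists_isAscendingRun (isReducedWord_map_rev hw)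
    have hb := wordPoset_col_bounds w
    rw [← WordPoset.index_mirror hb, ← (wordPoset_map_rev w).index_eq] at h
    obtain ⟨v, hv, hv'⟩ := hq.exists_contract (hq.index_eq_zero_iff.1 h)
    refine ⟨v.map Fin.rev, ?_, ?_⟩
    · have h1 := (hv.trans ((wordPoset_map_rev w).contract _ _)).trans
        (WordPoset.contract_mirror hb .D).symm
      refine ((wordPoset_map_rev v).trans (h1.mirror _)).trans (WordPoset.mirror_mirror ?_)
      exact fun x => (WordPoset.contract_col_le x).trans (hb x.1).2
    · rw [← traceEq_map_rev_iff, map_rev_appendChain, map_rev_map_rev]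
      exact hv'

theorem index_eq_zero_of_traceEq {w : List (Fin (m + 2))}
    (hw : IsReducedWord w (longestElement (m + 2))) (d : Dir) {v : List (Fin (m + 1))}
    (h : TraceEq (w.map Fin.val) ((appendChain d v).map Fin.val)) :
    (wordPoset w).index (m + 2) d = 0 := by
  cases d with
  | A =>
    obtain ⟨q, hq⟩ := exists_isAscendingRun hw
    exact hq.index_eq_zero_iff.2 (hq.le_of_traceEq h)
  | D =>
    obtain ⟨q, hq⟩ := exists_isAscendingRun (isReducedWord_map_rev hw)
    rw [← WordPoset.index_mirror (wordPoset_col_bounds w), ← (wordPoset_map_rev w).index_eq]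
    refine hq.index_eq_zero_iff.2 (hq.le_of_traceEq (v := v.map Fin.rev) ?_)
    rw [← traceEq_map_rev_iff, map_rev_appendChain] at h
    exact h

/-- The reduced words of the longest element with `δ`-index `0` form a single commutation class. -/
theorem isReducedWord_and_deltaIndex_eq_zero_iff (m : ℕ) (δ : Fin m → Dir)
    (w : List (Fin (m + 1))) :
    (IsReducedWord w (longestElement (m + 1)) ∧ (wordPoset w).deltaIndex m δ = 0) ↔
      TraceEq (w.map Fin.val) ((gcWord m δ).map Fin.val) := by
  have hred : ∀ m (δ : Fin m → Dir) (w : List (Fin (m + 1))),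
      TraceEq (w.map Fin.val) ((gcWord m δ).map Fin.val) →
        IsReducedWord w (longestElement (m + 1)) := fun m δ w h => by
    rw [isReducedWord_longestElement_iff, h.wordProd_eq, wordProd_gcWord, ← length_gcWord m δ]
    exact ⟨rfl, by simpa using h.length_eq⟩
  induction m with
  | zero =>
    refine ⟨fun h => ?_, fun h => ⟨hred _ _ _ h, Subsingleton.elim _ _⟩⟩
    have := (isReducedWord_longestElement_iff.1 h.1).2
    obtain ⟨x, rfl⟩ := List.length_eq_one_iff.1 this
    rw [Fin.fin_one_eq_zero x]
    exact .refl _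
  | succ m ih =>
    rw [WordPoset.deltaIndex_succ_eq_zero_iff]
    constructor
    · rintro ⟨hw, hidx, hδ⟩
      obtain ⟨v, hv, hwv⟩ := exists_contract_of_index_eq_zero hw _ hidx
      rw [← hv.deltaIndex_eq] at hδ
      refine hwv.trans (traceEq_appendChain_iff.2 ((ih _ v).1 ⟨?_, hδ⟩))
      rw [isReducedWord_longestElement_iff] at hw ⊢
      constructor
      · rw [← wordProd_gcWord m (Fin.init δ)]
        refine wordProd_appendChain_inj (δ (Fin.last m)) ?_
        rw [← hwv.wordProd_eq, hw.1]
        exact (wordProd_gcWord (m + 1) δ).symm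
      · have h1 := hwv.length_eq
        have h2 := length_gcWord (m + 1) δ
        rw [List.length_map, List.length_map, hw.2, length_appendChain] at h1
        rw [gcWord, length_appendChain, length_gcWord] at h2
        omega
    · intro h
      have hw := hred _ _ _ h
      have hidx := index_eq_zero_of_traceEq hw _ h
      obtain ⟨v, hv, hwv⟩ := exists_contract_of_index_eq_zero hw _ hidx
      refine ⟨hw, hidx, ?_⟩
      rw [← hv.deltaIndex_eq]
      exact ((ih _ v).2 (traceEq_appendChain_iff.1 (hwv.symm.trans h))).2

theorem gcWord_injective {m : ℕ} {δ δ' : Fin m → Dir}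
    (h : TraceEq ((gcWord m δ).map Fin.val) ((gcWord m δ').map Fin.val)) : δ = δ' := by
  induction m with
  | zero => exact Subsingleton.elim _ _
  | succ m ih =>
    have key : ∀ (v v' : List (Fin (m + 1))), ¬ TraceEq ((appendChain .A v).map Fin.val)
        ((appendChain .D v').map Fin.val) := fun v v' h => by
      have := h 0
      rw [map_val_appendChain_A, map_val_appendChain_D, adjFilter_append, adjFilter_append,
        adjFilter_reverse, adjFilter_range (by omega)] at this
      have := (List.append_inj' this rfl).2
      simp at this
    have hlast : δ (Fin.last m) = δ' (Fin.last m) := by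
      rw [gcWord, gcWord] at h
      rcases e : δ (Fin.last m) <;> rcases e' : δ' (Fin.last m) <;> try rfl
      all_goals rw [e, e'] at h
      · exact absurd h (key _ _)
      · exact absurd h.symm (key _ _)
    rw [gcWord, gcWord, hlast, traceEq_appendChain_iff] at h
    rw [← Fin.snoc_init_self δ, ← Fin.snoc_init_self δ', ih h, hlast]

end

section

variable {α : Type*}

/-! ### Words of a commutation class as linear extensions -/

/-- A word equivalent to the word of a labelled list is the word of a rearrangement of this list
that keeps the order of any two entries with equal or adjacent letters. -/
theorem TraceEq.exists_relabel {f : α → ℕ} {u : List ℕ} {ρ : List α} (h : TraceEq u (ρ.map f)) :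
    ∃ ρ' : List α, ρ'.map f = u ∧ ρ'.Perm ρ ∧
      ∀ j, ρ'.filter (fun a => f a = j ∨ f a = j + 1) =
        ρ.filter fun a => f a = j ∨ f a = j + 1 := by
  induction u using List.reverseRecOn generalizing ρ with
  | nil =>
    obtain rfl := List.map_eq_nil_iff.1 h.symm.eq_nil
    exact ⟨[], rfl, .refl _, fun _ => rfl⟩
  | append_singleton u y ih =>
    obtain ⟨X₁, X₂, hX, hcomm, hw⟩ := h.exists_of_concat
    obtain ⟨ρ₁, ρ', rfl, rfl, h'⟩ := List.map_eq_append_iff.1 hX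
    obtain ⟨x, ρ₂, rfl, rfl, rfl⟩ := List.map_eq_cons_iff.1 h'
    rw [← List.map_append] at hw
    obtain ⟨σ, rfl, hperm, hfil⟩ := ih hw
    refine ⟨σ ++ [x], by simp, ?_, fun j => ?_⟩
    · refine (hperm.append_right [x]).trans ?_
      rw [List.append_assoc]
      exact List.perm_append_comm.append_left ρ₁
    · rw [List.filter_append, hfil, List.filter_append, List.filter_append, List.append_assoc]
      congr 1
      by_cases hj : f x = j ∨ f x = j + 1
      · have : ρ₂.filter (fun a => f a = j ∨ f a = j + 1) = [] := by
          rw [List.filter_eq_nil_iff]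
          intro a ha
          have := hcomm (f a) (List.mem_map_of_mem ha)
          simp only [decide_eq_true_eq]
          omega
        have hx : decide (f x = j ∨ f x = j + 1) = true := decide_eq_true hj
        simp only [List.filter_cons, hx, if_true, List.filter_nil, this, List.nil_append]
      · rw [List.filter_cons_of_neg (by simpa using hj),
          List.filter_cons_of_neg (by simpa using hj)]
        simp

/-- A list is determined by its word together with its sublists on two adjacent letters. -/
theorem eq_of_map_eq_of_filter_eq {f : α → ℕ} {ρ σ : List α} (h : ρ.map f = σ.map f)
    (h' : ∀ j, ρ.filter (fun a => f a = j ∨ f a = j + 1) =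
      σ.filter fun a => f a = j ∨ f a = j + 1) : ρ = σ := by
  induction ρ generalizing σ with
  | nil => exact (List.map_eq_nil_iff.1 h.symm).symm
  | cons a ρ ih =>
    obtain ⟨b, σ, rfl, hb, ht⟩ := List.map_eq_cons_iff.1 h.symm
    obtain rfl : a = b := by
      have := h' (f a)
      rw [List.filter_cons_of_pos (by simp), List.filter_cons_of_pos (by simp [hb])] at this
      exact (List.cons.inj this).1
    rw [ih ht.symm fun j => ?_]
    have := h' j
    by_cases hj : f a = j ∨ f a = j + 1
    · rw [List.filter_cons_of_pos (by simpa using hj),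
        List.filter_cons_of_pos (by simpa using hj)] at this
      exact (List.cons.inj this).2
    · rwa [List.filter_cons_of_neg (by simpa using hj),
        List.filter_cons_of_neg (by simpa using hj)] at this

theorem pairwise_ofFn_symm {L : ℕ} (T : α ≃ Fin L) :
    (List.ofFn T.symm).Pairwise fun a b => T a < T b := by
  rw [List.pairwise_ofFn]
  intro i j hij
  simpa using hij

/-- The words equivalent to `ρ.map f` correspond to the linear extensions of `α` when the order on
`α` is generated by comparisons of entries with equal or adjacent letters, which `ρ` lists in
increasing order. -/
theorem ncard_traceEq_eq_card_monotone [PartialOrder α] {ρ : List α} (hnd : ρ.Nodup)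
    (hmem : ∀ a, a ∈ ρ) {L : ℕ} (hL : ρ.length = L) {f : α → ℕ}
    (hlt : ∀ j, (ρ.filter fun a => f a = j ∨ f a = j + 1).Pairwise (· < ·))
    (hgen : ∀ a b : α, a ≤ b → Relation.ReflTransGen
      (fun a b => a < b ∧ ∃ j, (f a = j ∨ f a = j + 1) ∧ (f b = j ∨ f b = j + 1)) a b) :
    {u | TraceEq u (ρ.map f)}.ncard = Nat.card {T : α ≃ Fin L // Monotone T} := by
  have hfil : ∀ T : α ≃ Fin L, Monotone T → ∀ j,
      (List.ofFn T.symm).filter (fun a => f a = j ∨ f a = j + 1) =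
        ρ.filter fun a => f a = j ∨ f a = j + 1 := fun T hT j => by
    have : Std.Irrefl fun a b : α => T a < T b := ⟨fun a => lt_irrefl _⟩
    refine List.Pairwise.eq_of_mem_iff (r := fun a b => T a < T b)
      ((pairwise_ofFn_symm T).filter _)
      ((hlt j).imp fun hab => hT.strictMono_of_injective T.injective hab) fun a => ?_
    simp only [List.mem_filter, hmem, true_and, and_iff_right_iff_imp, List.mem_ofFn]
    exact fun _ => T.symm.surjective a
  have hmap : ∀ T : {T : α ≃ Fin L // Monotone T},
      TraceEq ((List.ofFn T.1.symm).map f) (ρ.map f) := fun T j => by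
    rw [adjFilter, adjFilter, List.filter_map, List.filter_map]
    exact congrArg (List.map f) (hfil T.1 T.2 j)
  rw [← Nat.card_coe_set_eq]
  refine (Nat.card_congr (Equiv.ofBijective (β := {u | TraceEq u (ρ.map f)})
    (fun T : {T : α ≃ Fin L // Monotone T} => ⟨_, hmap T⟩) ⟨?_, ?_⟩)).symm
  · rintro ⟨T, hT⟩ ⟨T', hT'⟩ h
    have h2 := eq_of_map_eq_of_filter_eq (congrArg Subtype.val h) fun j => by
      rw [hfil T hT, hfil T' hT']
    have h3 : (T.symm : Fin L → α) = T'.symm := List.ofFn_injective h2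
    exact Subtype.ext (Equiv.symm_bijective.injective (Equiv.coe_fn_injective h3))
  · rintro ⟨u, hu⟩
    classical
    obtain ⟨ρ', rfl, hperm, hfil'⟩ := TraceEq.exists_relabel hu
    obtain ⟨e, hofFn⟩ : ∃ e : Fin L ≃ α, List.ofFn e = ρ' := by
      have hlen : ρ'.length = L := hperm.length_eq.trans hL
      subst hlen
      exact ⟨(hperm.nodup_iff.2 hnd).getEquivOfForallMemList ρ' fun a => hperm.mem_iff.2 (hmem a),
        List.ofFn_get ρ'⟩
    refine ⟨⟨e.symm, fun a b hab => ?_⟩, Subtype.ext ?_⟩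
    · have key : ∀ a b, a < b → (∃ j, (f a = j ∨ f a = j + 1) ∧ (f b = j ∨ f b = j + 1)) →
          e.symm a ≤ e.symm b := by
        rintro a b hab ⟨j, ha, hb⟩
        have hpw : (ρ.filter fun a => f a = j ∨ f a = j + 1).Pairwise
            fun a b => e.symm a < e.symm b := by
          rw [← hfil' j, ← hofFn]
          exact (pairwise_ofFn_symm e.symm).filter _
        have hpw' := (hpw.and (hlt j)).imp
          (S := fun a b => (e.symm a < e.symm b ∧ a < b) ∨ (e.symm b < e.symm a ∧ b < a)) Or.inl
        have hsymm : Std.Symm fun a b =>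
            (e.symm a < e.symm b ∧ a < b) ∨ (e.symm b < e.symm a ∧ b < a) := ⟨fun _ _ => Or.symm⟩
        rcases hpw'.forall (a := a) (b := b) (by simpa [hmem] using ha)
          (by simpa [hmem] using hb) hab.ne with h | h
        · exact h.1.le
        · exact absurd hab h.2.asymm
      induction hgen a b hab with
      | refl => exact le_rfl
      | tail h1 h2 ih =>
        have hle : ∀ {x y}, Relation.ReflTransGen (fun a b => a < b ∧ ∃ j,
            (f a = j ∨ f a = j + 1) ∧ (f b = j ∨ f b = j + 1)) x y → x ≤ y := fun h => by
          induction h with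
          | refl => exact le_rfl
          | tail _ h ih => exact ih.trans h.1.le
        exact (ih (hle h1)).trans (key _ _ h2.1 h2.2)
    · exact congrArg (List.map f) hofFn

/-! ### Descending chains and shifted tableaux -/

/-- The `i` descending chains `k, …, 0`, then `k + 1, …, 0`, and so on, up to `k + i - 1, …, 0`. -/
def descChains : ℕ → ℕ → List ℕ
  | _, 0 => []
  | k, i + 1 => (List.range (k + 1)).reverse ++ descChains (k + 1) i

theorem reverse_descChains (k i : ℕ) :
    (descChains k i).reverse = (List.range i).flatMap fun r => List.range (k + i - r) := by
  induction i generalizing k with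
  | zero => rfl
  | succ i ih =>
    rw [descChains, List.reverse_append, List.reverse_reverse, ih, List.range_succ (n := i),
      List.flatMap_append, List.flatMap_singleton, show k + (i + 1) - i = k + 1 by omega]
    congr 2
    funext r
    rw [show k + 1 + i - r = k + (i + 1) - r by omega]

/-- The cells of the shifted diagram of `(k + i, k + i - 1, …, k + 1)`, row by row. -/
def shiftedCells (k i : ℕ) : List (shiftedDiagram fun j : Fin i => k + i - (j : ℕ)) :=
  (List.finRange i).flatMap fun r : Fin i => (List.finRange (k + i - (r : ℕ))).map
    fun x : Fin (k + i - (r : ℕ)) =>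
    ⟨(r, r + x), Nat.le_add_right _ _, by
      have := x.2
      show (r : ℕ) + x < k + i - r + r
      omega⟩

/-- The diagonal of a cell; it is the letter that the cell contributes to a word. -/
def cellLetter {k i : ℕ} (a : shiftedDiagram fun j : Fin i => k + i - (j : ℕ)) : ℕ :=
  a.1.2 - a.1.1

theorem map_cellLetter_shiftedCells (k i : ℕ) :
    (shiftedCells k i).map cellLetter = (descChains k i).reverse := by
  rw [reverse_descChains, shiftedCells, List.map_flatMap]
  conv_rhs => rw [← map_val_finRange i, List.flatMap_map]
  congr 1
  funext r
  rw [List.map_map, ← map_val_finRange]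
  refine List.map_congr_left fun x _ => ?_
  simp [cellLetter]

theorem pairwise_shiftedCells (k i : ℕ) : (shiftedCells k i).Pairwise fun a b =>
    a.1.1 < b.1.1 ∨ a.1.1 = b.1.1 ∧ a.1.2 < b.1.2 := by
  rw [shiftedCells, List.pairwise_flatMap]
  refine ⟨fun r _ => ?_, ?_⟩
  · refine List.Pairwise.map _ (fun x y hxy => Or.inr ⟨rfl, ?_⟩) (List.sortedLT_finRange _).pairwise
    exact Nat.add_lt_add_left hxy _
  · refine (List.sortedLT_finRange _).pairwise.imp fun hrs a ha b hb => Or.inl ?_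
    obtain ⟨x, -, rfl⟩ := List.mem_map.1 ha
    obtain ⟨y, -, rfl⟩ := List.mem_map.1 hb
    exact hrs

theorem mem_shiftedCells {k i : ℕ} (a : shiftedDiagram fun j : Fin i => k + i - (j : ℕ)) :
    a ∈ shiftedCells k i := by
  obtain ⟨⟨r, c⟩, h1, h2⟩ := a
  simp only at h1 h2
  refine List.mem_flatMap.2 ⟨r, List.mem_finRange _, List.mem_map.2
    ⟨⟨c - r, by omega⟩, List.mem_finRange _, Subtype.ext (Prod.ext rfl ?_)⟩⟩
  simp only
  omega

theorem length_shiftedCells (k i : ℕ) :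
    (shiftedCells k i).length = ∑ j : Fin i, (k + i - (j : ℕ)) := by
  rw [shiftedCells, List.length_flatMap, Fin.sum_univ_def]
  simp

/-- The number of words equivalent to `v`. -/
noncomputable def traceCard (v : List ℕ) : ℕ := {w | TraceEq w v}.ncard

theorem traceCard_reverse (v : List ℕ) : traceCard v.reverse = traceCard v := by
  rw [traceCard, traceCard, ← Set.ncard_image_of_injective _ List.reverse_injective]
  congr 1
  ext w
  constructor
  · rintro ⟨u, hu, rfl⟩
    simpa using TraceEq.reverse hu
  · intro hw
    exact ⟨w.reverse, hw.reverse, by simp⟩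

/-- Read backwards, the descending chains are the rows of the shifted diagram, so the words
equivalent to them are the standard tableaux. -/
theorem traceCard_descChains (k i : ℕ) :
    traceCard (descChains k i) = numShiftedSYT fun j : Fin i => k + i - (j : ℕ) := by
  rw [← traceCard_reverse, ← map_cellLetter_shiftedCells, traceCard, numShiftedSYT]
  refine ncard_traceEq_eq_card_monotone ?_ mem_shiftedCells (length_shiftedCells k i) ?_ ?_
  · refine (pairwise_shiftedCells k i).imp ?_
    rintro a b h rfl
    exact h.elim (lt_irrefl _) fun h => lt_irrefl _ h.2
  · intro j
    rw [List.pairwise_filter]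
    refine (pairwise_shiftedCells k i).imp ?_
    rintro ⟨⟨r, c⟩, h1, h2⟩ ⟨⟨r', c'⟩, h1', h2'⟩ h ha hb
    replace ha := of_decide_eq_true ha
    replace hb := of_decide_eq_true hb
    simp only [cellLetter] at ha hb h h1 h2 h1' h2'
    refine lt_of_le_of_ne (Prod.mk_le_mk.2 ⟨?_, ?_⟩) ?_
    · rcases h with h | h
      · exact h.le
      · exact h.1.le
    · rw [Fin.lt_def, Fin.ext_iff] at h
      omega
    · intro e
      obtain ⟨rfl, rfl⟩ := Prod.mk.inj (Subtype.mk.inj e)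
      exact h.elim (lt_irrefl _) fun h => lt_irrefl _ h.2
  · have hrow : ∀ (d r c : ℕ) (hr : r < i) (h h'), Relation.ReflTransGen
        (fun a b : shiftedDiagram fun j : Fin i => k + i - (j : ℕ) => a < b ∧ ∃ j,
          (cellLetter a = j ∨ cellLetter a = j + 1) ∧ (cellLetter b = j ∨ cellLetter b = j + 1))
        ⟨(⟨r, hr⟩, c), h⟩ ⟨(⟨r, hr⟩, c + d), h'⟩ := by
      intro d r c hr h h'
      induction d with
      | zero => exact .refl
      | succ d ih =>
        obtain ⟨h1, h2⟩ := id h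
        obtain ⟨h1', h2'⟩ := id h'
        simp only at h1 h2 h1' h2'
        refine (ih ⟨by simp only; omega, by simp only; omega⟩).tail ⟨?_, c + d - r, ?_⟩
        · exact Prod.mk_lt_mk_iff_right.2 (by omega)
        · exact ⟨Or.inl rfl, Or.inr (by show c + (d + 1) - r = c + d - r + 1; omega)⟩
    have hcol : ∀ (d r c : ℕ) (hr : r < i) (hr' : r + d < i) (h h'), Relation.ReflTransGen
        (fun a b : shiftedDiagram fun j : Fin i => k + i - (j : ℕ) => a < b ∧ ∃ j,
          (cellLetter a = j ∨ cellLetter a = j + 1) ∧ (cellLetter b = j ∨ cellLetter b = j + 1))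
        ⟨(⟨r, hr⟩, c), h⟩ ⟨(⟨r + d, hr'⟩, c), h'⟩ := by
      intro d r c hr hr' h h'
      induction d with
      | zero => exact .refl
      | succ d ih =>
        obtain ⟨h1, h2⟩ := id h
        obtain ⟨h1', h2'⟩ := id h'
        simp only at h1 h2 h1' h2'
        refine (ih (by omega) ⟨by simp only; omega, by simp only; omega⟩).tail
          ⟨?_, c - (r + d + 1), ?_⟩
        · exact Prod.mk_lt_mk_iff_left.2 (Fin.mk_lt_mk.2 (by omega))
        · exact ⟨Or.inr (by show c - (r + d) = c - (r + d + 1) + 1; omega), Or.inl rfl⟩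
    rintro ⟨⟨⟨r, hr⟩, c⟩, h⟩ ⟨⟨⟨r', hr'⟩, c'⟩, h'⟩ hle
    obtain ⟨hrr, hcc⟩ := Prod.mk_le_mk.1 (show ((⟨r, hr⟩ : Fin i), c) ≤ (⟨r', hr'⟩, c') from hle)
    rw [Fin.mk_le_mk] at hrr
    obtain ⟨d, rfl⟩ := Nat.exists_eq_add_of_le hrr
    obtain ⟨d', rfl⟩ := Nat.exists_eq_add_of_le hcc
    obtain ⟨h1, h2⟩ := id h
    obtain ⟨h1', h2'⟩ := id h'
    simp only at h1 h2 h1' h2'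
    exact (hrow d' r c hr h ⟨by simp only; omega, by simp only; omega⟩).trans
      (hcol d r _ hr hr' _ h')

end

section

variable {m n : ℕ}

/-! ### Counting words of Gelfand–Cetlin type -/

theorem map_val_injective : Function.Injective (List.map (Fin.val : Fin n → ℕ)) :=
  List.map_injective_iff.2 Fin.val_injective

theorem image_setOf_traceEq (v : List (Fin n)) :
    List.map Fin.val '' {w : List (Fin n) | TraceEq (w.map Fin.val) (v.map Fin.val)} =
      {u | TraceEq u (v.map Fin.val)} := by
  ext u
  constructor
  · rintro ⟨w, hw, rfl⟩
    exact hw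
  · intro hu
    obtain ⟨w, rfl⟩ : u ∈ Set.range (List.map (Fin.val : Fin n → ℕ)) := by
      rw [Set.range_list_map]
      intro x hx
      obtain ⟨i, -, rfl⟩ := List.mem_map.1 (hu.mem_iff.1 hx)
      exact ⟨i, rfl⟩
    exact ⟨w, hu, rfl⟩

theorem ncard_setOf_traceEq (v : List (Fin n)) :
    {w : List (Fin n) | TraceEq (w.map Fin.val) (v.map Fin.val)}.ncard =
      traceCard (v.map Fin.val) := by
  rw [traceCard, ← image_setOf_traceEq, Set.ncard_image_of_injective _ map_val_injective]

theorem finite_setOf_map_val_traceEq (v : List (Fin n)) :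
    {w : List (Fin n) | TraceEq (w.map Fin.val) (v.map Fin.val)}.Finite := by
  refine Set.Finite.of_finite_image ?_ map_val_injective.injOn
  rw [image_setOf_traceEq]
  exact finite_setOf_traceEq _

theorem traceCard_map_rev (v : List (Fin n)) :
    traceCard ((v.map Fin.rev).map Fin.val) = traceCard (v.map Fin.val) := by
  rw [← ncard_setOf_traceEq, ← ncard_setOf_traceEq,
    ← Set.ncard_image_of_injective _ (List.map_injective_iff.2 (Fin.rev_injective (n := n)))]
  congr 1
  ext w
  constructor
  · rintro ⟨w, hw, rfl⟩
    have := TraceEq.map_rev hw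
    rwa [map_rev_map_rev] at this
  · intro hw
    exact ⟨w.map Fin.rev, TraceEq.map_rev hw, map_rev_map_rev w⟩

instance : Fintype Dir where
  elems := ⟨{Dir.A, Dir.D}, by simp⟩
  complete d := by cases d <;> simp

theorem sum_dir (f : Dir → ℕ) : ∑ d, f d = f .A + f .D := by
  show (Multiset.map f {Dir.A, Dir.D}).sum = _
  simp

theorem sum_snoc_dir (f : (Fin (m + 1) → Dir) → ℕ) :
    ∑ δ, f δ = ∑ δ : Fin m → Dir, (f (Fin.snoc δ .A) + f (Fin.snoc δ .D)) := by
  rw [← (Fin.snocEquiv fun _ : Fin (m + 1) => Dir).sum_comp, Fintype.sum_prod_type_right]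
  exact Finset.sum_congr rfl fun δ _ => sum_dir _

theorem gcWord_snoc (δ : Fin m → Dir) (d : Dir) :
    gcWord (m + 1) (Fin.snoc δ d) = appendChain d (gcWord m δ) := by
  rw [gcWord, Fin.snoc_last, Fin.init_snoc]

theorem gc_succ (m : ℕ) :
    gc (m + 1) = ∑ δ : Fin m → Dir, traceCard ((gcWord m δ).map Fin.val) := by
  have hset : {w : List (Fin (m + 1)) | IsReducedWord w (longestElement (m + 1)) ∧
      IsGelfandCetlinType w} =
      ⋃ δ : Fin m → Dir,
        {w : List (Fin (m + 1)) | TraceEq (w.map Fin.val) ((gcWord m δ).map Fin.val)} := by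
    ext w
    simp only [Set.mem_iUnion, Set.mem_ofPred_eq, ← isReducedWord_and_deltaIndex_eq_zero_iff]
    exact exists_and_left.symm
  rw [gc, hset, Set.ncard_iUnion_of_finite (fun δ => finite_setOf_map_val_traceEq _),
    finsum_eq_sum_of_fintype]
  · exact Finset.sum_congr rfl fun δ _ => ncard_setOf_traceEq _
  · intro δ δ' hne
    refine Set.disjoint_left.2 fun w hw hw' => hne (gcWord_injective ?_)
    exact TraceEq.trans (TraceEq.symm hw) hw'

theorem gc_zero : gc 0 = 1 := by
  rw [gc, Set.ncard_eq_one]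
  refine ⟨[], ?_⟩
  ext w
  obtain rfl : w = [] := by
    cases w with
    | nil => rfl
    | cons i _ => exact i.elim0
  simp only [Set.mem_ofPred_eq, Set.mem_singleton_iff, iff_true]
  refine ⟨⟨Subsingleton.elim (α := Equiv.Perm (Fin 1)) _ _, ?_⟩, Fin.elim0,
    Subsingleton.elim (α := Fin 0 → ℕ) _ _⟩
  have : permLength (longestElement 0) ≤ 0 :=
    Nat.sInf_le ⟨[], Subsingleton.elim (α := Equiv.Perm (Fin 1)) _ _, rfl⟩
  exact (Nat.le_zero.1 this).symm

theorem traceCard_singleton (x : ℕ) : traceCard [x] = 1 := by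
  rw [traceCard, Set.ncard_eq_one]
  refine ⟨[x], ?_⟩
  ext w
  exact ⟨fun h => h.perm.eq_singleton, fun h => by rw [h]; exact .refl _⟩

theorem gc_one : gc 1 = 1 := by
  rw [gc_succ, Fintype.sum_unique]
  exact traceCard_singleton 0

/-- A class whose words all end in `c`, followed by a class whose words all start with a letter `d`
adjacent to `c`: the words of the concatenation are the concatenations of words. -/
theorem traceCard_append {U V : List ℕ} {c d : ℕ}
    (hU : ∀ u y, TraceEq (u ++ [y]) U → y = c) (hV : ∀ v y, TraceEq (y :: v) V → y = d)
    (hcd : c + 1 = d ∨ d + 1 = c) :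
    traceCard (U ++ V) = traceCard U * traceCard V := by
  rw [traceCard, traceCard, traceCard, ← Set.ncard_prod,
    ← Set.InjOn.ncard_image (f := fun p : List ℕ × List ℕ => p.1 ++ p.2)]
  · congr 1
    ext w
    constructor
    · intro hw
      obtain ⟨w₁, w₂, rfl, h₁, h₂⟩ := TraceEq.exists_append_eq hU hcd w V hV hw
      exact ⟨(w₁, w₂), ⟨h₁, h₂⟩, rfl⟩
    · rintro ⟨⟨w₁, w₂⟩, ⟨h₁, h₂⟩, rfl⟩
      exact TraceEq.append h₁ h₂
  · rintro ⟨w₁, w₂⟩ ⟨h₁, -⟩ ⟨v₁, v₂⟩ ⟨h₁', -⟩ h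
    obtain ⟨rfl, rfl⟩ := List.append_inj h
      ((TraceEq.length_eq h₁).trans (TraceEq.length_eq h₁').symm)
    rfl

theorem adjFilter_descChains_head {i k j x : ℕ} {l : List ℕ} (hkj : k ≤ j)
    (h : adjFilter j (descChains k i) = x :: l) : x = j := by
  induction i generalizing k with
  | zero => cases h
  | succ i ih =>
    rw [descChains, adjFilter_append, adjFilter_reverse] at h
    rcases hkj.eq_or_lt with rfl | hlt
    · rw [List.range_succ, adjFilter_append, adjFilter_cons_of_pos _ (Or.inl rfl)] at h
      simp at h
      exact h.1.symm
    · rw [adjFilter_eq_nil] at h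
      · exact ih hlt h
      · intro y hy
        have := List.mem_range.1 hy
        omega

theorem head_eq_of_traceEq_descChains {k i y : ℕ} {v : List ℕ}
    (h : TraceEq (y :: v) (descChains k i)) : y = k := by
  rcases lt_trichotomy y k with hlt | rfl | hgt
  · cases i with
    | zero => exact absurd h.eq_nil (by simp)
    | succ i =>
      have := h y
      rw [adjFilter_cons_of_pos _ (Or.inl rfl), descChains, adjFilter_append, adjFilter_reverse,
        adjFilter_range (by omega)] at this
      simp at this
  · rfl
  · have := h (y - 1)
    rw [adjFilter_cons_of_pos _ (Or.inr (by omega))] at this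
    have := adjFilter_descChains_head (by omega) this.symm
    omega

theorem last_eq_of_traceEq_appendChain {v : List (Fin n)} {u : List ℕ} {y : ℕ}
    (h : TraceEq (u ++ [y]) ((appendChain .A v).map Fin.val)) : y = n := by
  have hy : y < n + 1 := by
    obtain ⟨i, -, rfl⟩ := List.mem_map.1 (h.mem_iff.1 (by simp : y ∈ u ++ [y]))
    exact i.2
  by_contra hne
  have := h y
  rw [map_val_appendChain_A, adjFilter_append, adjFilter_append, adjFilter_range (by omega),
    adjFilter_cons_of_pos _ (Or.inl rfl)] at this
  have h2 : adjFilter y u ++ [y] = adjFilter y ((v.map Fin.val).map (· + 1)) ++ [y] ++ [y + 1] := by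
    simpa using this
  have := (List.append_inj' h2 rfl).2
  simp at this

/-- The number of words, over all `δ`, in the class of `gcWord m δ` followed by `i` descending
chains on growing alphabets. -/
noncomputable def descTailCount (m i : ℕ) : ℕ :=
  ∑ δ : Fin m → Dir, traceCard ((gcWord m δ).map Fin.val ++ descChains (m + 1) i)

theorem sum_traceCard_appendChain_D (m : ℕ) :
    ∑ δ : Fin m → Dir, traceCard ((appendChain .D (gcWord m δ)).map Fin.val) =
      ∑ δ : Fin m → Dir, traceCard ((appendChain .A (gcWord m δ)).map Fin.val) := by
  have hinv : Function.Involutive fun (δ : Fin m → Dir) i => (δ i).flip := fun δ =>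
    funext fun i => Dir.flip_flip _
  refine Fintype.sum_equiv hinv.toPerm _ _ fun δ => ?_
  rw [← traceCard_map_rev, map_rev_appendChain, map_rev_gcWord]
  rfl

theorem gc_add_two (m : ℕ) :
    gc (m + 2) = 2 * ∑ δ : Fin m → Dir, traceCard ((appendChain .A (gcWord m δ)).map Fin.val) := by
  rw [gc_succ, sum_snoc_dir, two_mul]
  simp only [gcWord_snoc, Finset.sum_add_distrib, sum_traceCard_appendChain_D]

theorem gc_add_two_eq (m : ℕ) : gc (m + 2) = 2 * descTailCount m 1 := by
  rw [gc_add_two, ← sum_traceCard_appendChain_D, descTailCount]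
  simp only [map_val_appendChain_D, descChains, List.append_nil]

/-- Split by the last letter of `δ`: an `A` separates the descending chains from what precedes, a
`D` provides one more descending chain. -/
theorem two_mul_descTailCount_succ (m i : ℕ) :
    2 * descTailCount (m + 1) i =
      gc (m + 2) * traceCard (descChains (m + 2) i) + 2 * descTailCount m (i + 1) := by
  have h : descTailCount (m + 1) i =
      (∑ δ : Fin m → Dir, traceCard ((appendChain .A (gcWord m δ)).map Fin.val)) *
        traceCard (descChains (m + 2) i) + descTailCount m (i + 1) := by
    rw [descTailCount, sum_snoc_dir, Finset.sum_add_distrib, Finset.sum_mul, descTailCount]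
    congr 1
    · refine Finset.sum_congr rfl fun δ _ => ?_
      rw [gcWord_snoc]
      exact traceCard_append (fun _ _ => last_eq_of_traceEq_appendChain)
        (fun _ _ => head_eq_of_traceEq_descChains) (Or.inl rfl)
    · refine Finset.sum_congr rfl fun δ _ => ?_
      rw [gcWord_snoc, map_val_appendChain_D, descChains, List.append_assoc]
  rw [h, gc_add_two]
  ring

/-- The words with descending chains only. They are counted once with the starting letter `0` split
off and once with it read as a chain of length one, which gives the last two terms of the sum. -/
theorem two_mul_descTailCount_zero (i : ℕ) :
    2 * descTailCount 0 (i + 1) =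
      gc 1 * traceCard (descChains 1 (i + 1)) + gc 0 * traceCard (descChains 0 (i + 2)) := by
  have h1 : descTailCount 0 (i + 1) = traceCard ([0] ++ descChains 1 (i + 1)) :=
    Fintype.sum_unique _
  have h2 : descChains 0 (i + 2) = [0] ++ descChains 1 (i + 1) := rfl
  rw [h2, ← h1, gc_one, gc_zero]
  have h3 : descTailCount 0 (i + 1) = traceCard (descChains 1 (i + 1)) := by
    rw [h1, traceCard_append (c := 0) (fun u y h => ?_)
      (fun _ _ => head_eq_of_traceEq_descChains) (Or.inl rfl), traceCard_singleton, one_mul]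
    simpa using (h.mem_iff (x := y)).1 (by simp)
  rw [← h3]
  ring

theorem two_mul_descTailCount (m i : ℕ) :
    2 * descTailCount m (i + 1) = ∑ l ∈ Finset.range (m + 2),
      gc (m + 1 - l) * traceCard (descChains (m + 1 - l) (i + 1 + l)) := by
  induction m generalizing i with
  | zero => rw [two_mul_descTailCount_zero]; simp [Finset.sum_range_succ]
  | succ m ih =>
    rw [two_mul_descTailCount_succ, ih, Finset.sum_range_succ' _ (m + 2), add_comm]
    congr 1
    refine Finset.sum_congr rfl fun l _ => ?_
    rw [show m + 1 + 1 - (l + 1) = m + 1 - l by omega,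
      show i + 1 + (l + 1) = i + 1 + 1 + l by omega]

end

end GelfandCetlin

theorem theorem4p13 :
    GelfandCetlin.gc 0 = 1 ∧ GelfandCetlin.gc 1 = 1 ∧
      ∀ n : ℕ, 2 ≤ n →
        GelfandCetlin.gc n =
          ∑ i ∈ Finset.Icc 1 n,
            GelfandCetlin.numShiftedSYT (fun j : Fin i => n - (j : ℕ)) *
              GelfandCetlin.gc (n - i) := by
  refine ⟨GelfandCetlin.gc_zero, GelfandCetlin.gc_one, fun n hn => ?_⟩
  obtain ⟨m, rfl⟩ := Nat.exists_eq_add_of_le' hn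
  rw [GelfandCetlin.gc_add_two_eq, GelfandCetlin.two_mul_descTailCount m 0]
  refine Finset.sum_nbij' (· + 1) (· - 1) (fun l hl => ?_) (fun i hi => ?_) (fun l _ => rfl)
    (fun i hi => ?_) fun l hl => ?_
  · rw [Finset.mem_range] at hl
    exact Finset.mem_Icc.2 (by omega)
  · rw [Finset.mem_Icc] at hi
    exact Finset.mem_range.2 (by omega)
  · rw [Finset.mem_Icc] at hi
    exact Nat.sub_add_cancel hi.1
  · rw [Finset.mem_range] at hl
    rw [GelfandCetlin.traceCard_descChains, mul_comm, show m + 2 - (l + 1) = m + 1 - l by omega,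
      show 0 + 1 + l = l + 1 by omega, show m + 1 - l + (l + 1) = m + 2 by omega]
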